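/- Let $c>0$, $\lambda>0$, $t>0$, $m\in\{0,1\}$ and let $n\ge 1$ be an integer. Put $v_0=\frac n2$ and $v_1=n+1$. For $\nu\ge 0$, let $X_\nu(s)$, $s\ge 0$, be the position of a particle on the real line that starts at the origin, moves with velocity $c\cos\theta_1$ until the first event of a homogeneous Poisson process $N$ of rate $\lambda$, then with velocity $c\cos\theta_2$ until the second event, and so on: $$X_\nu(s)=c\sum_{j=1}^{N(s)+1}(s_j-s_{j-1})\cos\theta_j,$$ where $s_0=0$, $s_1<\dots<s_{N(s)}$ are the event times in $(0,s]$, $s_{N(s)+1}=s$, and the $\theta_j$ are i.i.d., independent of $N$, with density $\frac{\Gamma(\nu+1)}{\sqrt\pi\,\Gamma(\nu+\frac12)}\sin^{2\nu}\theta$ on $(0,\pi)$. If $\tau>0$ is a random time independent of $N$ and of the $\theta_j$, the law of $X_\nu(\tau)$ given $k$ changes of velocity is the probability measure $$\mathcal L_k\big(X_\nu(\tau)\big)(A)=\int_0^\infty P\{X_\nu(\tau)\in A\mid \tau=s,\ N(\tau)=k\}\,P\{\tau\in ds\}=\int_0^\infty P\{X_\nu(s)\in A\mid N(s)=k\}\,P\{\tau\in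 ds\}.$$ Let $B$ be a standard Brownian motion independent of $N$ and of the $\theta_j$, and let $\Gamma(t)=\int_0^t\mathbf 1_{\{B(s)>0\}}\,ds$ be its sojourn time on the positive half-line up to time $t$. Then $\Gamma(t)$ follows the arcsine law, with density $\frac1{\pi\sqrt{s(t-s)}}$ for $0<s<t$, and: 1. $\mathcal L_n(X_m(\Gamma(t)))$ is absolutely continuous with density $$x\mapsto\frac{1}{B(1,v_m)\,\pi}\int_0^t\frac{ds}{\sqrt{s(t-s)}}\int_0^1(1-w)^{v_m-1}\,\frac1\pi\,\frac{\mathbf 1_{\{|x|<cs\sqrt w\}}}{\sqrt{c^2s^2w-x^2}}\,dw,$$ where $B(a,b)=\Gamma(a)\Gamma(b)/\Gamma(a+b)$ is the Beta function. 2. $\mathcal L_n\big(X_m(\Gamma(t))\big)=\mathcal L_0\big(X_0(\Gamma(t)\sqrt W)\big)$, where $W$ has the Beta distribution with parameters $1$ and $v_m$, and $B$, $W$ and the Poisson process and angles that define $X_0$ are independent. In words, given $n$ changes of velocity, $X_m$ at time $\Gamma(t)$ has the law of $X_0$ run without any change of velocity for the time $\Gamma(t)\sqrt W$. -/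

import Mathlib

open MeasureTheory ProbabilityTheory
open scoped NNReal ENNReal

namespace FrictionMotion

/-- Density of the angle on `(0, π)`, with level of inertia `ν`. -/
noncomputable def angleDensity (ν θ : ℝ) : ℝ :=
  Real.Gamma (ν + 1) / (Real.sqrt Real.pi * Real.Gamma (ν + 1 / 2)) * Real.sin θ ^ (2 * ν)

/-- Law of the angle with level of inertia `ν`. -/
noncomputable def angleLaw (ν : ℝ) : Measure ℝ :=
  (volume.restrict (Set.Ioo 0 Real.pi)).withDensity fun θ => ENNReal.ofReal (angleDensity ν θ)

variable {Ω : Type*}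

/-- `eventTime E j` is the time of the `j`-th event (`eventTime E 0 = 0`), when `E 0, E 1, …` are
the successive waiting times. -/
def eventTime (E : ℕ → Ω → ℝ) (j : ℕ) (ω : Ω) : ℝ :=
  ∑ i ∈ Finset.range j, E i ω

/-- Number of events in `(0, s]`. For independent exponential waiting times of rate `lam`, this is
the homogeneous Poisson process of rate `lam`. -/
noncomputable def eventCount (E : ℕ → Ω → ℝ) (s : ℝ) (ω : Ω) : ℕ :=
  Set.ncard {j : ℕ | eventTime E (j + 1) ω ≤ s}

/-- Position at time `s` of the particle that starts at the origin and has velocity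
`c * cos (θ j)` between the `j`-th and the `(j+1)`-th event: the sum over the completed legs plus
the current leg, which is cut at time `s`. -/
noncomputable def position (c : ℝ) (E θ : ℕ → Ω → ℝ) (s : ℝ) (ω : Ω) : ℝ :=
  c * (∑ j ∈ Finset.range (eventCount E s ω),
        (eventTime E (j + 1) ω - eventTime E j ω) * Real.cos (θ j ω)
      + (s - eventTime E (eventCount E s ω) ω) * Real.cos (θ (eventCount E s ω) ω))

/-- The random inputs of the motion with level of inertia `ν` and rate `lam`: the waiting times of
a Poisson process of rate `lam` and, independent of them, an i.i.d. sequence of angles. -/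
structure IsMotionInput [MeasurableSpace Ω] (lam ν : ℝ) (E θ : ℕ → Ω → ℝ) (P : Measure Ω) :
    Prop where
  measurable_wait : ∀ j, Measurable (E j)
  measurable_angle : ∀ j, Measurable (θ j)
  law_wait : ∀ j, HasLaw (E j) (expMeasure lam) P
  law_angle : ∀ j, HasLaw (θ j) (angleLaw ν) P
  indep_wait : iIndepFun E P
  indep_angle : iIndepFun θ P
  indep_wait_angle : IndepFun (fun ω j => E j ω) (fun ω j => θ j ω) P

/-- Time spent by `B` on the positive half-line up to time `t`. -/
noncomputable def sojournTime (B : ℝ≥0 → Ω → ℝ) (t : ℝ) (ω : Ω) : ℝ :=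
  ∫ s in (0 : ℝ)..t, Set.indicator {s : ℝ | 0 < B s.toNNReal ω} 1 s

/-- The arcsine law on `(0, t)`. -/
noncomputable def arcsineLaw (t : ℝ) : Measure ℝ :=
  (volume.restrict (Set.Ioo 0 t)).withDensity fun s =>
    ENNReal.ofReal (1 / (Real.pi * Real.sqrt (s * (t - s))))

/-- Law of the motion `X` stopped at the random clock `τ`, given that it has performed `n` changes
of velocity: `∫ P(X_τ ∈ · | τ = s, N_τ = n) P(τ ∈ ds)`. Only the number of switches is conditioned
upon: the clock keeps its own law. When `τ` is positive and independent of a Poisson process `N`,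
one has `P(N_s = n) > 0` for `P(τ ∈ ds)`-almost every `s`, so the integrand is determined almost
everywhere, and this is a bona fide law. -/
noncomputable def lawAtClock [MeasurableSpace Ω] (P : Measure Ω) [IsFiniteMeasure P]
    (N : ℝ → Ω → ℕ) (X : ℝ → Ω → ℝ) (τ : Ω → ℝ) (n : ℕ) : Measure ℝ :=
  (P.map τ).bind fun s =>
    condDistrib (fun ω => X (τ ω) ω) (fun ω => (τ ω, N (τ ω) ω)) P (s, n)

/-- The parameters `v₀ = n / 2` and `v₁ = n + 1`. -/
noncomputable def shape (m : Fin 2) (n : ℕ) : ℝ :=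
  if m = 0 then (n : ℝ) / 2 else (n : ℝ) + 1

end FrictionMotion

/-! ### Laws with bounded support are determined by their moments -/

namespace FrictionMotion

/-! At a fixed time `s`, given `n` changes of velocity, the position is `c * s * ξ` in law, where
the law of `ξ` depends only on `m` and `n`. The core of the proof is that `ξ` has the law of `√W *
cos Θ`, with `Θ` uniform on `(0, π)` and `W` an independent Beta variable of parameters `1` and
`shape m n` (here `n ≥ 1`). All these laws have bounded support, so comparing moments is enough.

Given `n` events, the `n + 1` legs cut the time interval at uniform points. Hence the `p`-th moment
of `ξ` is `p! n! / (n + p)!` times the coefficient of `x ^ p` in the power `n + 1` of the generating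
function of the moments of `cos θ`; `integral_legPow` proves this by renewal at the first event. Odd
moments vanish. In the variable `x ^ 2` the series is `(1 - x)^(-1/2)` for `m = 0` and the Catalan
series at `x / 4` for `m = 1`. The coefficients of its powers obey one first-order recurrence
containing `shape m n` (`coeff_cosSeries_pow_succ`), and after the factorial normalization it is the
recurrence of the even moments of `√W * cos Θ` (`betaMoment_mul_arcsineMoment`).

Since the clock is independent of the motion, conditioning on its value `s` and on the count gives
the fixed-time law for almost every `s` (`ae_condDistrib_eq`); the law at the clock is therefore the
mixture of the laws of `c * s * ξ`. For the sojourn time, Tonelli yields the density. Reading `s *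
(√w * cos θ)` as `(s * √w) * cos θ` yields the identity with `X_0` at the shortened clock, because
with no change of velocity the position is the time multiplied by `c * cos θ`.

The arcsine law itself also comes from moments. Brownian motion on a grid is a symmetric walk. By
Sparre Andersen's principle its number of positive positions is distributed as the index of its
first maximum, which takes the value `k` with probability `u k * u (n - k)`, where `u =
arcsineMoment` whatever the step law. The binomial moments of the count are then explicit for each
grid, and they converge to the moments of the sojourn time. -/

theorem measure_ext_of_moments {μ ν : Measure ℝ} [IsFiniteMeasure μ] [IsFiniteMeasure ν] {R : ℝ}
    (hμ : ∀ᵐ x ∂μ, |x| ≤ R) (hν : ∀ᵐ x ∂ν, |x| ≤ R)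
    (h : ∀ n : ℕ, ∫ x, x ^ n ∂μ = ∫ x, x ^ n ∂ν) : μ = ν := by
  have integrable_cont : ∀ (ρ : Measure ℝ) [IsFiniteMeasure ρ], (∀ᵐ x ∂ρ, |x| ≤ R) →
      ∀ f : ℝ → ℝ, Continuous f → Integrable f ρ := by
    intro ρ _ hρ f hf
    obtain ⟨C, hC⟩ := (isCompact_Icc (a := -R) (b := R)).exists_bound_of_continuousOn
      hf.continuousOn
    refine Integrable.of_bound hf.aestronglyMeasurable C ?_
    filter_upwards [hρ] with x hx using hC x (abs_le.mp hx)
  have hpoly : ∀ p : Polynomial ℝ, ∫ x, p.eval x ∂μ = ∫ x, p.eval x ∂ν := by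
    intro p
    simp_rw [Polynomial.eval_eq_sum_range]
    rw [integral_finsetSum _ fun i _ => integrable_cont μ hμ _ (by fun_prop),
      integral_finsetSum _ fun i _ => integrable_cont ν hν _ (by fun_prop)]
    refine Finset.sum_congr rfl fun i _ => ?_
    rw [integral_const_mul, integral_const_mul, h i]
  refine ext_of_forall_integral_eq_of_IsFiniteMeasure (μ := μ) (ν := ν) fun f => ?_
  -- Weierstrass approximation on `[-R, R]`, which carries both measures; polynomials have equal
  -- integrals.
  have close : ∀ ε > 0, |∫ x, f x ∂μ - ∫ x, f x ∂ν| ≤ ε * (μ.real Set.univ + ν.real Set.univ) := by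
    intro ε hε
    obtain ⟨p, hp⟩ := exists_polynomial_near_of_continuousOn (-R) R f f.continuous.continuousOn ε hε
    have key : ∀ (ρ : Measure ℝ) [IsFiniteMeasure ρ], (∀ᵐ x ∂ρ, |x| ≤ R) →
        |∫ x, f x ∂ρ - ∫ x, p.eval x ∂ρ| ≤ ε * ρ.real Set.univ := by
      intro ρ _ hρ
      rw [← integral_sub (integrable_cont ρ hρ _ f.continuous)
        (integrable_cont ρ hρ _ p.continuous)]
      rw [← Real.norm_eq_abs]
      refine norm_integral_le_of_norm_le_const (μ := ρ) ?_
      filter_upwards [hρ] with x hx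
      rw [Real.norm_eq_abs, abs_sub_comm]
      exact (hp x (abs_le.mp hx)).le
    have h1 := abs_le.mp (key μ hμ)
    have h2 := abs_le.mp (key ν hν)
    rw [hpoly p] at h1
    rw [abs_le]
    constructor <;> linarith [h1.1, h1.2, h2.1, h2.2]
  have hM : 0 ≤ μ.real Set.univ + ν.real Set.univ := by positivity
  refine eq_of_forall_dist_le fun ε hε => ?_
  rw [Real.dist_eq]
  -- The `+ 1` keeps the denominator positive even when both measures vanish.
  refine (close (ε / (μ.real Set.univ + ν.real Set.univ + 1)) (by positivity)).trans ?_
  rw [div_mul_eq_mul_div, div_le_iff₀ (by positivity)]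
  nlinarith

/-! ### Walks and Sparre Andersen's principle -/

/-- The walk with steps `x 0, x 1, …`. -/
def walk (x : ℕ → ℝ) (j : ℕ) : ℝ := ∑ i ∈ Finset.range j, x i

/-- The number of positive positions of the walk at the times `1, …, n`. -/
noncomputable def positiveTime (x : ℕ → ℝ) (n : ℕ) : ℕ :=
  ∑ j ∈ Finset.range n, if 0 < walk x (j + 1) then 1 else 0

/-- The walk attains its maximum over `0, …, n` for the first time at `k`. -/
def FirstMaxAt (n k : ℕ) (x : ℕ → ℝ) : Prop :=
  k ≤ n ∧ (∀ j < k, walk x j < walk x k) ∧ ∀ j, k < j → j ≤ n → walk x j ≤ walk x k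

lemma walk_zero (x : ℕ → ℝ) : walk x 0 = 0 := by simp [walk]

lemma walk_succ (x : ℕ → ℝ) (j : ℕ) : walk x (j + 1) = walk x j + x j := by
  simp [walk, Finset.sum_range_succ]

lemma walk_shift (x : ℕ → ℝ) (k j : ℕ) :
    walk (fun i => x (k + i)) j = walk x (k + j) - walk x k := by
  simp [walk, Finset.sum_range_add]

lemma walk_congr {x y : ℕ → ℝ} {n : ℕ} (h : ∀ i < n, x i = y i) {j : ℕ} (hj : j ≤ n) :
    walk x j = walk y j :=
  Finset.sum_congr rfl fun i hi => h i (by have := Finset.mem_range.mp hi; omega)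

@[fun_prop]
lemma measurable_walk (j : ℕ) : Measurable fun x : ℕ → ℝ => walk x j := by
  unfold walk; fun_prop

lemma positiveTime_succ (x : ℕ → ℝ) (n : ℕ) :
    positiveTime x (n + 1) = positiveTime x n + if 0 < walk x (n + 1) then 1 else 0 := by
  exact Finset.sum_range_succ _ _

lemma positiveTime_le (x : ℕ → ℝ) (n : ℕ) : positiveTime x n ≤ n := by
  induction n with
  | zero => simp [positiveTime]
  | succ n ih => rw [positiveTime_succ]; split_ifs <;> omega

@[fun_prop]
lemma measurable_positiveTime (n : ℕ) : Measurable fun x : ℕ → ℝ => positiveTime x n := by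
  unfold positiveTime
  refine Finset.measurable_fun_sum _ fun j _ => ?_
  exact Measurable.ite (measurableSet_lt measurable_const (measurable_walk _))
    measurable_const measurable_const

lemma measurableSet_firstMaxAt (n k : ℕ) : MeasurableSet {x | FirstMaxAt n k x} := by
  unfold FirstMaxAt
  refine measurableSet_setOfPred.2 (measurable_const.and (.and ?_ ?_))
  · exact Measurable.forall fun j => measurable_const.imp
      (measurableSet_setOfPred.1 (measurableSet_lt (measurable_walk _) (measurable_walk _)))
  · exact Measurable.forall fun j => measurable_const.imp (measurable_const.imp
      (measurableSet_setOfPred.1 (measurableSet_le (measurable_walk _) (measurable_walk _))))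

lemma firstMaxAt_congr {x y : ℕ → ℝ} {n k : ℕ} (h : ∀ i < n, x i = y i) :
    FirstMaxAt n k x ↔ FirstMaxAt n k y := by
  unfold FirstMaxAt
  refine and_congr_right fun hk => and_congr ?_ ?_
  · refine forall₂_congr fun j hj => ?_
    rw [walk_congr h (by omega : j ≤ n), walk_congr h hk]
  · refine forall₃_congr fun j _ hj => ?_
    rw [walk_congr h hj, walk_congr h hk]

/-- The walk starts at `0`, so a final position that is not positive can neither be a strict new
maximum nor exceed the old one. -/
lemma firstMaxAt_succ_of_nonpos {x : ℕ → ℝ} {n k : ℕ} (h : walk x (n + 1) ≤ 0) :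
    FirstMaxAt (n + 1) k x ↔ FirstMaxAt n k x := by
  constructor
  · rintro ⟨hk, h1, h2⟩
    have hkn : k ≠ n + 1 := by
      rintro rfl
      have := h1 0 (by omega)
      rw [walk_zero] at this
      linarith
    exact ⟨by omega, h1, fun j hj hj' => h2 j hj (by omega)⟩
  · rintro ⟨hk, h1, h2⟩
    refine ⟨by omega, h1, fun j hj hj' => ?_⟩
    rcases Nat.lt_or_ge n j with hjn | hjn
    · obtain rfl : j = n + 1 := by omega
      rcases Nat.eq_zero_or_pos k with rfl | hk0
      · rwa [walk_zero]
      · have := h1 0 hk0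
        rw [walk_zero] at this
        linarith
    · exact h2 j hj hjn

lemma firstMaxAt_zero_of_pos {x : ℕ → ℝ} {n : ℕ} (h : 0 < walk x (n + 1)) :
    ¬ FirstMaxAt (n + 1) 0 x := by
  rintro ⟨_, _, h2⟩
  have := h2 (n + 1) (by omega) le_rfl
  rw [walk_zero] at this
  linarith

/-- Dropping the first step shifts the index of the maximum by one. The only condition lost is that
the maximum exceeds the initial value `0`, and it is automatic because the maximum is at least the
positive final position. -/
lemma firstMaxAt_succ_succ_of_pos {x : ℕ → ℝ} {n k : ℕ} (h : 0 < walk x (n + 1)) :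
    FirstMaxAt (n + 1) (k + 1) x ↔ FirstMaxAt n k fun i => x (1 + i) := by
  unfold FirstMaxAt
  simp only [walk_shift, sub_lt_sub_iff_right, sub_le_sub_iff_right]
  constructor
  · rintro ⟨hk, h1, h2⟩
    refine ⟨by omega, fun j hj => ?_, fun j hj hj' => ?_⟩
    · rw [add_comm 1 k]; exact h1 _ (by omega)
    · rw [add_comm 1 k]; exact h2 _ (by omega) (by omega)
  · rintro ⟨hk, h1, h2⟩
    refine ⟨by omega, fun j hj => ?_, fun j hj hj' => ?_⟩
    · rcases Nat.eq_zero_or_pos j with rfl | hj0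
      · rw [walk_zero]
        rcases hk.eq_or_lt with rfl | hk
        · exact h
        · have := h2 n hk le_rfl
          rw [add_comm 1 n, add_comm 1 k] at this
          linarith
      · obtain ⟨j, rfl⟩ := Nat.exists_eq_add_of_le hj0
        rw [add_comm k 1]; exact h1 _ (by omega)
    · obtain ⟨j, rfl⟩ := Nat.exists_eq_add_of_le (show 1 ≤ j by omega)
      rw [add_comm k 1]; exact h2 _ (by omega) (by omega)

/-- Invariance of a measure on sequences under the permutations of the first `n` terms. -/
def Exchangeable (n : ℕ) (μ : Measure (ℕ → ℝ)) : Prop :=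
  ∀ σ : Equiv.Perm ℕ, (∀ i, n ≤ i → σ i = i) → μ.map (fun x => x ∘ σ) = μ

lemma measurable_comp_perm (σ : Equiv.Perm ℕ) : Measurable fun x : ℕ → ℝ => x ∘ σ :=
  measurable_pi_lambda _ fun i => measurable_pi_apply (σ i)

lemma walk_comp_perm {n : ℕ} {σ : Equiv.Perm ℕ} (hσ : ∀ i, n ≤ i → σ i = i) (x : ℕ → ℝ) :
    walk (x ∘ σ) n = walk x n := by
  refine Finset.sum_equiv σ (fun i => ?_) fun i _ => rfl
  simp only [Finset.mem_range]
  constructor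
  · intro hi
    by_contra! h
    have := σ.injective (hσ _ h)
    omega
  · intro hi
    by_contra! h
    rw [hσ _ h] at hi
    omega

/-- The sum of the first `n` steps is invariant under their permutations. The induction can
therefore condition on the sign of the final position without losing exchangeability. -/
lemma Exchangeable.restrict {n : ℕ} {μ : Measure (ℕ → ℝ)} (hμ : Exchangeable n μ)
    {s : Set ℝ} (hs : MeasurableSet s) :
    Exchangeable n (μ.restrict {x | walk x n ∈ s}) := by
  intro σ hσ
  have hms : MeasurableSet {x : ℕ → ℝ | walk x n ∈ s} := measurable_walk n hs
  have hpre : {x : ℕ → ℝ | walk x n ∈ s} = (fun x => x ∘ σ) ⁻¹' {x | walk x n ∈ s} := by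
    ext x; simp [walk_comp_perm hσ x]
  conv_lhs => rw [hpre]
  rw [← Measure.restrict_map (measurable_comp_perm σ) hms, hμ σ hσ]

lemma Exchangeable.mono {m n : ℕ} {μ : Measure (ℕ → ℝ)} (hμ : Exchangeable n μ) (h : m ≤ n) :
    Exchangeable m μ := fun σ hσ => hμ σ fun i hi => hσ i (h.trans hi)

/-- The cyclic permutation `0 ↦ 1 ↦ ⋯ ↦ n ↦ 0`. -/
def rotation (n : ℕ) : Equiv.Perm ℕ where
  toFun i := if i < n then 1 + i else if i = n then 0 else i
  invFun i := if i = 0 then n else if i ≤ n then i - 1 else i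
  left_inv i := by dsimp only; split_ifs <;> omega
  right_inv i := by dsimp only; split_ifs <;> omega

/-- The permutation that reverses the order of the first `n` integers. -/
def reversal (n : ℕ) : Equiv.Perm ℕ where
  toFun i := if i < n then n - 1 - i else i
  invFun i := if i < n then n - 1 - i else i
  left_inv i := by dsimp only; split_ifs <;> omega
  right_inv i := by dsimp only; split_ifs <;> omega

/-- **Sparre Andersen's equivalence principle.** -/
theorem Exchangeable.measure_positiveTime {n : ℕ} {μ : Measure (ℕ → ℝ)} (hμ : Exchangeable n μ)
    (k : ℕ) : μ {x | positiveTime x n = k} = μ {x | FirstMaxAt n k x} := by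
  induction n generalizing k μ with
  | zero =>
    congr 1; ext x
    simp only [positiveTime, Finset.range_zero, Finset.sum_empty, FirstMaxAt, Set.mem_ofPred_eq]
    constructor
    · rintro rfl; exact ⟨le_rfl, by simp, fun j h1 h2 => by omega⟩
    · rintro ⟨h, _⟩; omega
  | succ n ih =>
    have hneg : MeasurableSet {x : ℕ → ℝ | walk x (n + 1) ∈ Set.Iic 0} :=
      measurable_walk _ measurableSet_Iic
    have hpos : MeasurableSet {x : ℕ → ℝ | walk x (n + 1) ∈ Set.Ioi 0} :=
      measurable_walk _ measurableSet_Ioi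
    have hcompl : {x : ℕ → ℝ | walk x (n + 1) ∈ Set.Iic 0}ᶜ = {x | walk x (n + 1) ∈ Set.Ioi 0} := by
      ext x; simp
    rw [← measure_inter_add_sdiff {x | positiveTime x (n + 1) = k} hneg,
      ← measure_inter_add_sdiff {x | FirstMaxAt (n + 1) k x} hneg, Set.sdiff_eq, Set.sdiff_eq, hcompl]
    congr 1
    -- When the final position is not positive, the last step changes neither the count nor the
    -- first maximum.
    · have := ih ((hμ.restrict (measurableSet_Iic (a := (0 : ℝ)))).mono n.le_succ) k
      rw [Measure.restrict_apply' hneg, Measure.restrict_apply' hneg] at this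
      convert this using 2
      · ext x
        refine and_congr_left fun hx => ?_
        have hx : ¬ 0 < walk x (n + 1) := not_lt.mpr hx
        simp [positiveTime_succ, hx]
      · ext x
        exact and_congr_left fun hx => firstMaxAt_succ_of_nonpos hx
    · rcases k with _ | k
      · trans 0
        · convert measure_empty (μ := μ)
          ext x
          simp only [Set.mem_inter_iff, Set.mem_ofPred_eq, Set.mem_Ioi, Set.mem_empty_iff_false,
            iff_false, not_and, positiveTime_succ]
          intro h hx
          simp [hx] at h
        · symm
          convert measure_empty (μ := μ)
          ext x
          simp only [Set.mem_inter_iff, Set.mem_ofPred_eq, Set.mem_Ioi, Set.mem_empty_iff_false,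
            iff_false, not_and]
          exact fun h hx => firstMaxAt_zero_of_pos hx h
      -- When the final position is positive, the count loses one by forgetting the last step and
      -- the index of the maximum loses one by forgetting the first step. The rotation, which
      -- preserves the restricted measure, matches the two.
      · have hex := hμ.restrict (s := Set.Ioi 0) measurableSet_Ioi
        have h1 := ih (hex.mono n.le_succ) k
        have h2 := hex (rotation n) fun i hi => by
          simp only [rotation, Equiv.coe_fn_mk]; split_ifs <;> omega
        rw [← h2, Measure.map_apply (measurable_comp_perm _) (measurableSet_firstMaxAt n k), h2,
          Measure.restrict_apply' hpos, Measure.restrict_apply' hpos] at h1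
        convert h1 using 2
        · ext x
          refine and_congr_left fun hx => ?_
          have hx : 0 < walk x (n + 1) := hx
          simp [positiveTime_succ, hx]
        · ext x
          refine and_congr_left fun hx => ?_
          rw [Set.mem_ofPred_eq, firstMaxAt_succ_succ_of_pos hx, Set.mem_preimage, Set.mem_ofPred_eq]
          exact firstMaxAt_congr fun i hi => by simp [rotation, hi]

/-! ### Independent steps and the discrete arcsine law -/

section iid

variable {𝓧 : Type*} [MeasurableSpace 𝓧] (ν : Measure 𝓧) [IsProbabilityMeasure ν]

lemma indepFun_head_tail (k : ℕ) :
    IndepFun (fun (x : ℕ → 𝓧) (i : Finset.range k) => x i) (fun x i => x (k + i))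
      (Measure.infinitePi fun _ : ℕ => ν) := by
  have hind : iIndepFun (fun (i : ℕ) (x : ℕ → 𝓧) => x i) (Measure.infinitePi fun _ : ℕ => ν) :=
    iIndepFun_infinitePi (X := fun _ x => x) (fun _ => measurable_id)
  refine IndepFun.indepFun_process (by fun_prop) (by fun_prop) fun J => ?_
  have hd : Disjoint (Finset.range k) (J.map (addLeftEmbedding k)) := by
    rw [Finset.disjoint_left]
    intro a ha hb
    simp only [Finset.mem_map, addLeftEmbedding_apply, Finset.mem_range] at ha hb
    omega
  have h := hind.indepFun_finset _ _ hd (by fun_prop)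
  have hψ : Measurable fun (y : J.map (addLeftEmbedding k) → 𝓧) (j : J) =>
      y ⟨k + j, by simp⟩ := measurable_pi_lambda _ fun j => measurable_pi_apply _
  exact h.comp measurable_id hψ

lemma map_shift_infinitePi (k : ℕ) :
    (Measure.infinitePi fun _ : ℕ => ν).map (fun x i => x (k + i)) =
      Measure.infinitePi fun _ : ℕ => ν :=
  Measure.map_infinitePi_infinitePi_of_inj (P := fun _ : ℕ => ν) (add_right_injective k)

lemma map_head_tail_infinitePi :
    (Measure.infinitePi fun _ : ℕ => ν).map (fun x => (x 0, fun i => x (1 + i))) =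
      ν.prod (Measure.infinitePi fun _ : ℕ => ν) := by
  have hφ : Measurable fun y : Finset.range 1 → 𝓧 => y ⟨0, Finset.mem_range.2 one_pos⟩ :=
    measurable_pi_apply _
  have h : IndepFun (fun x : ℕ → 𝓧 => x 0) (fun x i => x (1 + i))
      (Measure.infinitePi fun _ : ℕ => ν) := (indepFun_head_tail ν 1).comp hφ measurable_id
  have h' := (indepFun_iff_map_prod_eq_prod_map_map (measurable_pi_apply 0).aemeasurable
    (measurable_pi_lambda _ fun i => measurable_pi_apply (1 + i)).aemeasurable).1 h
  rwa [map_shift_infinitePi, Measure.infinitePi_map_eval (fun _ : ℕ => ν) 0] at h'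

end iid

lemma exchangeable_infinitePi (ν : Measure ℝ) [IsProbabilityMeasure ν] (n : ℕ) :
    Exchangeable n (Measure.infinitePi fun _ : ℕ => ν) := fun σ _ =>
  Measure.map_infinitePi_infinitePi_of_inj (P := fun _ : ℕ => ν) σ.injective

/-- The probability that a walk with steps of law `ν` is positive at the times `1, …, n`. -/
noncomputable def persistence (ν : Measure ℝ) [IsProbabilityMeasure ν] (n : ℕ) : ℝ :=
  (Measure.infinitePi fun _ : ℕ => ν).real {x | ∀ j < n, 0 < walk x (j + 1)}

lemma walk_neg (x : ℕ → ℝ) (j : ℕ) : walk (fun i => -x i) j = -walk x j := by simp [walk]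

lemma walk_reversal (x : ℕ → ℝ) {j k : ℕ} (hj : j ≤ k) :
    walk (x ∘ reversal k) j = walk x k - walk x (k - j) := by
  induction j with
  | zero => simp [walk_zero]
  | succ j ih =>
    rw [walk_succ, ih (by omega)]
    obtain ⟨d, rfl⟩ := Nat.exists_eq_add_of_le hj
    have h1 : j + 1 + d - j = d + 1 := by omega
    have h2 : j + 1 + d - (j + 1) = d := by omega
    have h3 : reversal (j + 1 + d) j = d := by
      simp only [reversal, Equiv.coe_fn_mk]; split_ifs <;> omega
    rw [h1, h2, walk_succ, Function.comp_apply, h3]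
    ring

lemma measurableSet_walk_pos (n : ℕ) : MeasurableSet {x : ℕ → ℝ | ∀ j < n, 0 < walk x (j + 1)} :=
  measurableSet_setOfPred.2 <| Measurable.forall fun _ => measurable_const.imp
    (measurableSet_setOfPred.1 (measurableSet_lt measurable_const (measurable_walk _)))

lemma measurableSet_walk_nonpos (n : ℕ) :
    MeasurableSet {x : ℕ → ℝ | ∀ j < n, walk x (j + 1) ≤ 0} :=
  measurableSet_setOfPred.2 <| Measurable.forall fun _ => measurable_const.imp
    (measurableSet_setOfPred.1 (measurableSet_le (measurable_walk _) measurable_const))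

section symmetric

variable {ν : Measure ℝ} [IsProbabilityMeasure ν]

/-- Symmetry turns nonpositive walks into nonnegative ones, and the absence of ties makes these
positive. -/
lemma measure_walk_nonpos (hsymm : ν.map (fun x => -x) = ν)
    (h0 : ∀ j, ∀ᵐ x ∂(Measure.infinitePi fun _ : ℕ => ν), walk x (j + 1) ≠ 0) (n : ℕ) :
    (Measure.infinitePi fun _ : ℕ => ν).real {x | ∀ j < n, walk x (j + 1) ≤ 0} =
      persistence ν n := by
  have hneg : (Measure.infinitePi fun _ : ℕ => ν).map (fun x i => -x i) =
      Measure.infinitePi fun _ : ℕ => ν := by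
    rw [Measure.infinitePi_map_pi (μ := fun _ : ℕ => ν) (f := fun _ x => -x)
      fun _ => measurable_neg]
    congr 1; ext1; exact hsymm
  rw [← hneg, map_measureReal_apply (by fun_prop) (measurableSet_walk_nonpos n)]
  refine measureReal_congr ?_
  filter_upwards [ae_all_iff.2 h0] with x hx
  refine propext (forall₂_congr fun j _ => ?_)
  simp only [walk_neg, neg_nonpos]
  exact ⟨fun h => lt_of_le_of_ne h (hx j).symm, le_of_lt⟩

/-- Duality: reversing the order of the first `k` steps turns a strict maximum at time `k` into
positivity at the times `1, …, k`. -/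
lemma measure_lt_walk (k : ℕ) :
    (Measure.infinitePi fun _ : ℕ => ν).real {x | ∀ j < k, walk x j < walk x k} =
      persistence ν k := by
  have hσ : (Measure.infinitePi fun _ : ℕ => ν).map (fun x => x ∘ reversal k) =
      Measure.infinitePi fun _ : ℕ => ν :=
    exchangeable_infinitePi ν k _ fun i hi => by
      simp only [reversal, Equiv.coe_fn_mk]; split_ifs <;> omega
  rw [persistence, ← hσ, map_measureReal_apply (measurable_comp_perm _)
    (measurableSet_walk_pos k), hσ]
  congr 1
  ext x
  simp only [Set.mem_preimage, Set.mem_ofPred_eq]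
  constructor
  · intro h j hj
    rw [walk_reversal x (by omega), sub_pos]
    exact h _ (by omega)
  · intro h j hj
    have := h (k - j - 1) (by omega)
    rwa [walk_reversal x (by omega), sub_pos, show k - (k - j - 1 + 1) = j by omega] at this

/-- The condition before `k` involves only the first `k` steps and the condition after `k` only the
later ones, so independence factors the probability. -/
lemma measure_firstMaxAt (hsymm : ν.map (fun x => -x) = ν)
    (h0 : ∀ j, ∀ᵐ x ∂(Measure.infinitePi fun _ : ℕ => ν), walk x (j + 1) ≠ 0) {n k : ℕ}
    (hk : k ≤ n) :
    (Measure.infinitePi fun _ : ℕ => ν).real {x | FirstMaxAt n k x} =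
      persistence ν k * persistence ν (n - k) := by
  set μ := Measure.infinitePi fun _ : ℕ => ν with hμ
  -- Padding by zeros writes the event before `k` as a preimage under the finite head, the form
  -- required by `indepFun_head_tail`.
  let ext0 : (Finset.range k → ℝ) → ℕ → ℝ := fun y i =>
    if h : i ∈ Finset.range k then y ⟨i, h⟩ else 0
  have hext0 : Measurable ext0 := by
    refine measurable_pi_lambda _ fun i => ?_
    by_cases h : i ∈ Finset.range k
    · simp only [ext0, h, dite_true]; fun_prop
    · simp only [ext0, h, dite_false]; fun_prop
  have hhead : MeasurableSet {x : ℕ → ℝ | ∀ j < k, walk x j < walk x k} :=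
    measurableSet_setOfPred.2 <| Measurable.forall fun j => measurable_const.imp
      (measurableSet_setOfPred.1 (measurableSet_lt (measurable_walk _) (measurable_walk _)))
  have hset : {x | FirstMaxAt n k x} =
      (fun (x : ℕ → ℝ) (i : Finset.range k) => x i) ⁻¹'
        (ext0 ⁻¹' {x | ∀ j < k, walk x j < walk x k}) ∩
      (fun x i => x (k + i)) ⁻¹' {x | ∀ j < n - k, walk x (j + 1) ≤ 0} := by
    ext x
    have hc : ∀ j ≤ k, walk (ext0 fun i => x i) j = walk x j := fun j hj =>
      walk_congr (fun i hi => by simp [ext0, hi]) hj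
    simp only [Set.mem_inter_iff, Set.mem_preimage, Set.mem_ofPred_eq, FirstMaxAt, hk, true_and,
      walk_shift, sub_nonpos]
    refine and_congr (forall₂_congr fun j hj => ?_) ⟨fun h j hj => ?_, fun h j hj hj' => ?_⟩
    · rw [hc j hj.le, hc k le_rfl]
    · exact h _ (by omega) (by omega)
    · have := h (j - k - 1) (by omega)
      rwa [show k + (j - k - 1 + 1) = j by omega] at this
  rw [hset, measureReal_def, (indepFun_head_tail ν k).measure_inter_preimage_eq_mul _ _
    (hext0 hhead) (measurableSet_walk_nonpos _), ENNReal.toReal_mul, ← measureReal_def,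
    ← measureReal_def]
  congr 1
  · rw [← measure_lt_walk]
    congr 1
    ext x
    have hc : ∀ j ≤ k, walk (ext0 fun i => x i) j = walk x j := fun j hj =>
      walk_congr (fun i hi => by simp [ext0, hi]) hj
    simp only [Set.mem_preimage, Set.mem_ofPred_eq]
    refine forall₂_congr fun j hj => ?_
    rw [hc j hj.le, hc k le_rfl]
  · rw [← map_measureReal_apply (by fun_prop) (measurableSet_walk_nonpos _), map_shift_infinitePi,
      measure_walk_nonpos hsymm h0]

/-- The discrete arcsine law. -/
theorem measure_positiveTime (hsymm : ν.map (fun x => -x) = ν)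
    (h0 : ∀ j, ∀ᵐ x ∂(Measure.infinitePi fun _ : ℕ => ν), walk x (j + 1) ≠ 0) {n k : ℕ}
    (hk : k ≤ n) :
    (Measure.infinitePi fun _ : ℕ => ν).real {x | positiveTime x n = k} =
      persistence ν k * persistence ν (n - k) := by
  rw [measureReal_def, (exchangeable_infinitePi ν n).measure_positiveTime, ← measureReal_def,
    measure_firstMaxAt hsymm h0 hk]

lemma integral_comp_positiveTime (hsymm : ν.map (fun x => -x) = ν)
    (h0 : ∀ j, ∀ᵐ x ∂(Measure.infinitePi fun _ : ℕ => ν), walk x (j + 1) ≠ 0) (n : ℕ)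
    (f : ℕ → ℝ) :
    ∫ x, f (positiveTime x n) ∂(Measure.infinitePi fun _ : ℕ => ν) =
      ∑ k ∈ Finset.range (n + 1), f k * (persistence ν k * persistence ν (n - k)) := by
  have hsum : ∀ x, f (positiveTime x n) = ∑ k ∈ Finset.range (n + 1),
      Set.indicator {x | positiveTime x n = k} (fun _ => f k) x := by
    intro x
    rw [Finset.sum_eq_single (positiveTime x n)]
    · simp
    · intro k _ hk
      exact Set.indicator_of_notMem (by simpa using hk.symm) _
    · intro h
      have := positiveTime_le x n
      simp at h
      omega
  have hm : ∀ k, MeasurableSet {x : ℕ → ℝ | positiveTime x n = k} := fun k =>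
    measurable_positiveTime n (measurableSet_singleton k)
  simp_rw [hsum]
  rw [integral_finsetSum _ fun k _ => (integrable_const _).indicator (hm k)]
  refine Finset.sum_congr rfl fun k hk => ?_
  rw [integral_indicator_const _ (hm k),
    measure_positiveTime hsymm h0 (by simpa [Nat.lt_succ_iff] using hk), smul_eq_mul, mul_comm]

end symmetric

/-! ### Binomial moments of the discrete arcsine law -/

/-- The moments of the arcsine law on `(0, 1)`. -/
noncomputable def arcsineMoment (k : ℕ) : ℝ := k.centralBinom / 4 ^ k

lemma arcsineMoment_zero : arcsineMoment 0 = 1 := by simp [arcsineMoment]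

lemma arcsineMoment_succ (k : ℕ) :
    (k + 1) * arcsineMoment (k + 1) = (k + 1 / 2) * arcsineMoment k := by
  have h : ((k + 1 : ℕ) : ℝ) * (k + 1).centralBinom = (2 * (2 * k + 1) : ℕ) * k.centralBinom := by
    exact_mod_cast Nat.succ_mul_centralBinom_succ k
  push_cast at h
  rw [arcsineMoment, arcsineMoment, pow_succ, mul_div_assoc', h]
  field_simp
  ring

lemma cast_succ_sub_mul_choose (k r : ℕ) :
    ((k : ℝ) + 1 - r) * (k + 1).choose r = (k + 1) * k.choose r := by
  rcases le_or_gt r (k + 1) with h | h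
  · have := Nat.choose_mul_succ_eq k r
    rw [← Nat.cast_inj (R := ℝ)] at this
    push_cast [h] at this
    linarith
  · simp [Nat.choose_eq_zero_of_lt h, Nat.choose_eq_zero_of_lt (show k < r by omega)]

/-- Write `n + 1 - r` as `(p.1 - r) + p.2` and shift the index in each half. By `arcsineMoment_succ`
the halves acquire the factors `p.1 + 1 / 2` and `p.2 + 1 / 2`, whose sum is `n + 1`. -/
lemma sum_choose_mul_arcsineMoment_succ (n r : ℕ) :
    ((n : ℝ) + 1 - r) * ∑ p ∈ Finset.HasAntidiagonal.antidiagonal (n + 1),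
        (p.1.choose r : ℝ) * (arcsineMoment p.1 * arcsineMoment p.2) =
      (n + 1) * ∑ p ∈ Finset.HasAntidiagonal.antidiagonal n,
        (p.1.choose r : ℝ) * (arcsineMoment p.1 * arcsineMoment p.2) := by
  have hsplit : ((n : ℝ) + 1 - r) * ∑ p ∈ Finset.HasAntidiagonal.antidiagonal (n + 1),
        (p.1.choose r : ℝ) * (arcsineMoment p.1 * arcsineMoment p.2) =
      ∑ p ∈ Finset.HasAntidiagonal.antidiagonal (n + 1),
        ((p.1 : ℝ) - r) * p.1.choose r * (arcsineMoment p.1 * arcsineMoment p.2) +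
      ∑ p ∈ Finset.HasAntidiagonal.antidiagonal (n + 1),
        (p.1.choose r : ℝ) * (arcsineMoment p.1 * (p.2 * arcsineMoment p.2)) := by
    rw [Finset.mul_sum, ← Finset.sum_add_distrib]
    refine Finset.sum_congr rfl fun p hp => ?_
    have : ((p.1 : ℝ) + p.2) = n + 1 := by exact_mod_cast Finset.HasAntidiagonal.mem_antidiagonal.mp hp
    rw [← this]; ring
  rw [hsplit, Finset.Nat.sum_antidiagonal_succ, Finset.Nat.sum_antidiagonal_succ', Finset.mul_sum]
  have hzero : ((0 : ℝ) - r) * (Nat.choose 0 r : ℝ) = 0 := by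
    rcases r with _ | r <;> simp
  simp only [hzero, zero_mul, Nat.cast_zero, mul_zero, zero_add]
  rw [← Finset.sum_add_distrib]
  refine Finset.sum_congr rfl fun p hp => ?_
  have h1 := arcsineMoment_succ p.1
  have h2 := arcsineMoment_succ p.2
  have h3 := cast_succ_sub_mul_choose p.1 r
  have : ((p.1 : ℝ) + p.2) = n := by exact_mod_cast Finset.HasAntidiagonal.mem_antidiagonal.mp hp
  push_cast
  rw [h3, h2, ← this]
  linear_combination (p.1.choose r : ℝ) * arcsineMoment p.2 * h1

lemma sum_choose_mul_arcsineMoment (n r : ℕ) :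
    ∑ p ∈ Finset.HasAntidiagonal.antidiagonal n, (p.1.choose r : ℝ) * (arcsineMoment p.1 * arcsineMoment p.2) =
      n.choose r * arcsineMoment r := by
  -- The recurrence is void at `n + 1 = r`, where its left factor vanishes. For `n ≤ r` only the
  -- pair `(n, 0)` can contribute.
  have small : ∀ n ≤ r, ∑ p ∈ Finset.HasAntidiagonal.antidiagonal n,
      (p.1.choose r : ℝ) * (arcsineMoment p.1 * arcsineMoment p.2) =
      n.choose r * arcsineMoment r := by
    intro n hn
    rw [Finset.sum_eq_single (n, 0)]
    · rcases hn.eq_or_lt with rfl | hn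
      · simp [arcsineMoment_zero]
      · simp [Nat.choose_eq_zero_of_lt hn]
    · rintro ⟨a, b⟩ hp hne
      have hab := Finset.HasAntidiagonal.mem_antidiagonal.mp hp
      have : a < r := by
        simp only at hab
        rcases Nat.eq_zero_or_pos b with rfl | hb
        · exact absurd (by simpa using hab) hne
        · omega
      simp [Nat.choose_eq_zero_of_lt this]
    · simp
  induction n with
  | zero => exact small 0 (Nat.zero_le r)
  | succ n ih =>
    rcases Nat.lt_or_ge n r with h | h
    · exact small _ h
    · have h1 := sum_choose_mul_arcsineMoment_succ n r
      have h2 := cast_succ_sub_mul_choose n r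
      have hne : ((n : ℝ) + 1 - r) ≠ 0 := by
        have : (r : ℝ) ≤ n := by exact_mod_cast h
        linarith
      rw [ih] at h1
      apply mul_left_cancel₀ hne
      rw [h1, ← mul_assoc, ← mul_assoc, h2]

lemma sum_arcsineMoment (n : ℕ) :
    ∑ p ∈ Finset.HasAntidiagonal.antidiagonal n, arcsineMoment p.1 * arcsineMoment p.2 = 1 := by
  simpa [arcsineMoment_zero] using sum_choose_mul_arcsineMoment n 0

/-- For positive index the unknown `u n` enters the `n`-th identity linearly, with coefficient `2 *
u 0`, so the convolution square determines the sequence. -/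
lemma eq_arcsineMoment {u : ℕ → ℝ} (h0 : u 0 = 1)
    (h : ∀ n, ∑ p ∈ Finset.HasAntidiagonal.antidiagonal n, u p.1 * u p.2 = 1) (n : ℕ) : u n = arcsineMoment n := by
  induction n using Nat.strong_induction_on with
  | _ n ih =>
    rcases n with _ | n
    · rw [h0, arcsineMoment_zero]
    have h1 := (h (n + 1)).trans (sum_arcsineMoment (n + 1)).symm
    rcases n with _ | n
    · simp [Finset.Nat.sum_antidiagonal_succ, h0, arcsineMoment_zero] at h1
      simpa using by linarith
    rw [Finset.Nat.sum_antidiagonal_succ, Finset.Nat.sum_antidiagonal_succ',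
      Finset.Nat.sum_antidiagonal_succ, Finset.Nat.sum_antidiagonal_succ', h0,
      arcsineMoment_zero] at h1
    have : ∑ p ∈ Finset.HasAntidiagonal.antidiagonal n, u (p.1 + 1) * u (p.2 + 1) =
        ∑ p ∈ Finset.HasAntidiagonal.antidiagonal n, arcsineMoment (p.1 + 1) * arcsineMoment (p.2 + 1) := by
      refine Finset.sum_congr rfl fun p hp => ?_
      have := Finset.HasAntidiagonal.mem_antidiagonal.mp hp
      rw [ih _ (by omega), ih _ (by omega)]
    simp only at h1
    linarith

section symmetric

variable {ν : Measure ℝ} [IsProbabilityMeasure ν]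

/-- The law of the positive time has total mass one for every `n`, and this alone determines the
persistence probabilities. -/
lemma persistence_eq (hsymm : ν.map (fun x => -x) = ν)
    (h0 : ∀ j, ∀ᵐ x ∂(Measure.infinitePi fun _ : ℕ => ν), walk x (j + 1) ≠ 0) (n : ℕ) :
    persistence ν n = arcsineMoment n := by
  refine eq_arcsineMoment (by simp [persistence]) (fun n => ?_) n
  have := integral_comp_positiveTime hsymm h0 n fun _ => 1
  rw [Finset.Nat.sum_antidiagonal_eq_sum_range_succ_mk]
  simpa using this.symm

theorem integral_choose_positiveTime (hsymm : ν.map (fun x => -x) = ν)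
    (h0 : ∀ j, ∀ᵐ x ∂(Measure.infinitePi fun _ : ℕ => ν), walk x (j + 1) ≠ 0) (n r : ℕ) :
    ∫ x, ((positiveTime x n).choose r : ℝ) ∂(Measure.infinitePi fun _ : ℕ => ν) =
      n.choose r * arcsineMoment r := by
  rw [integral_comp_positiveTime hsymm h0 n fun k => (k.choose r : ℝ),
    ← sum_choose_mul_arcsineMoment, Finset.Nat.sum_antidiagonal_eq_sum_range_succ_mk]
  simp_rw [persistence_eq hsymm h0]

end symmetric

/-! ### The laws of the angles -/

lemma integral_cos_pow_add_two {a b : ℝ} (n : ℕ) (ha : Real.sin a = 0)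
    (hb : Real.cos b ^ (n + 1) * Real.sin b = 0) :
    ∫ x in a..b, Real.cos x ^ (n + 2) = (n + 1) / (n + 2) * ∫ x in a..b, Real.cos x ^ n := by
  rw [integral_cos_pow, ha, hb]; simp

/-- The hypothesis on `b` covers both `π`, for the angle laws, and `π / 2`, which the half-angle
substitution produces for the arcsine law. -/
lemma integral_cos_pow_even {a b : ℝ} (ha : Real.sin a = 0)
    (hb : Real.cos b * Real.sin b = 0) (k : ℕ) :
    ∫ x in a..b, Real.cos x ^ (2 * k) = (b - a) * arcsineMoment k := by
  induction k with
  | zero => simp [arcsineMoment_zero]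
  | succ k ih =>
    have h := arcsineMoment_succ k
    rw [show 2 * (k + 1) = 2 * k + 2 by ring, integral_cos_pow_add_two _ ha
      (by rw [pow_succ, mul_assoc, hb, mul_zero]), ih]
    have h' : arcsineMoment (k + 1) = (2 * k + 1) / (2 * k + 2) * arcsineMoment k := by
      field_simp
      linarith
    rw [h']
    push_cast
    ring

lemma integral_cos_pow_odd (k : ℕ) :
    ∫ x in (0 : ℝ)..Real.pi, Real.cos x ^ (2 * k + 1) = 0 := by
  induction k with
  | zero => simp
  | succ k ih =>
    rw [show 2 * (k + 1) + 1 = 2 * k + 1 + 2 by ring, integral_cos_pow_add_two _ (by simp) (by simp),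
      ih, mul_zero]

lemma angleDensity_zero (θ : ℝ) : angleDensity 0 θ = 1 / Real.pi := by
  have h : Real.Gamma (1 / 2) = Real.sqrt Real.pi := Real.Gamma_one_half_eq
  simp only [angleDensity, zero_add, Real.Gamma_one, h, mul_zero, Real.rpow_zero, mul_one]
  rw [Real.mul_self_sqrt Real.pi_pos.le]

lemma angleDensity_one (θ : ℝ) : angleDensity 1 θ = 2 / Real.pi * Real.sin θ ^ 2 := by
  have h : Real.Gamma (1 / 2) = Real.sqrt Real.pi := Real.Gamma_one_half_eq
  have h1 : Real.Gamma (1 + 1) = 1 := by rw [Real.Gamma_add_one one_ne_zero]; simp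
  have h2 : Real.Gamma (1 + 1 / 2) = 1 / 2 * Real.sqrt Real.pi := by
    rw [add_comm, Real.Gamma_add_one (by norm_num), h]
  rw [angleDensity, h1, h2, mul_one, Real.rpow_two]
  congr 1
  rw [mul_left_comm, Real.mul_self_sqrt Real.pi_pos.le]
  field_simp

lemma angleDensity_nonneg {ν : ℝ} (hν : 0 ≤ ν) {θ : ℝ} (hθ : θ ∈ Set.Ioo 0 Real.pi) :
    0 ≤ angleDensity ν θ := by
  have h1 := Real.Gamma_pos_of_pos (show 0 < ν + 1 by linarith)
  have h2 := Real.Gamma_pos_of_pos (show 0 < ν + 1 / 2 by linarith)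
  have h3 := Real.sin_pos_of_mem_Ioo hθ
  unfold angleDensity
  positivity

@[fun_prop]
lemma measurable_angleDensity (ν : ℝ) : Measurable (angleDensity ν) := by
  unfold angleDensity; fun_prop

lemma integral_angleLaw {ν : ℝ} (hν : 0 ≤ ν) (f : ℝ → ℝ) :
    ∫ θ, f θ ∂angleLaw ν = ∫ θ in (0 : ℝ)..Real.pi, angleDensity ν θ * f θ := by
  rw [angleLaw, integral_withDensity_eq_integral_toReal_smul (by fun_prop) (by simp),
    intervalIntegral.integral_of_le Real.pi_pos.le, integral_Ioc_eq_integral_Ioo]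
  refine setIntegral_congr_fun measurableSet_Ioo fun θ hθ => ?_
  simp [ENNReal.toReal_ofReal (angleDensity_nonneg hν hθ)]

/-- The even moments of `cos Θ` when `Θ` has the law `angleLaw m`. -/
noncomputable def cosMoment (m : Fin 2) (k : ℕ) : ℝ :=
  if m = 0 then arcsineMoment k else arcsineMoment k / (k + 1)

lemma integral_cos_pow_even_angleLaw (m : Fin 2) (k : ℕ) :
    ∫ θ, Real.cos θ ^ (2 * k) ∂angleLaw ((m : ℕ) : ℝ) = cosMoment m k := by
  rw [integral_angleLaw (by positivity)]
  fin_cases m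
  · simp only [Fin.zero_eta, Nat.cast_zero, angleDensity_zero]
    rw [intervalIntegral.integral_const_mul, integral_cos_pow_even (by simp) (by simp)]
    simp only [cosMoment, if_true]
    have := Real.pi_pos
    field_simp
    ring
  · simp only [Fin.mk_one, Nat.cast_one, angleDensity_one]
    have : ∀ θ, 2 / Real.pi * Real.sin θ ^ 2 * Real.cos θ ^ (2 * k) =
        2 / Real.pi * (Real.cos θ ^ (2 * k) - Real.cos θ ^ (2 * (k + 1))) := fun θ => by
      rw [Real.sin_sq]; ring
    simp_rw [this]
    rw [intervalIntegral.integral_const_mul, intervalIntegral.integral_sub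
      (Continuous.intervalIntegrable (by fun_prop) _ _)
      (Continuous.intervalIntegrable (by fun_prop) _ _),
      integral_cos_pow_even (by simp) (by simp), integral_cos_pow_even (by simp) (by simp)]
    have h := arcsineMoment_succ k
    have h' : arcsineMoment (k + 1) = (k + 1 / 2) / (k + 1) * arcsineMoment k := by
      field_simp; linarith
    rw [h']
    simp only [cosMoment, one_ne_zero, if_false]
    have := Real.pi_pos
    field_simp
    ring

lemma integral_cos_pow_odd_angleLaw (m : Fin 2) (k : ℕ) :
    ∫ θ, Real.cos θ ^ (2 * k + 1) ∂angleLaw ((m : ℕ) : ℝ) = 0 := by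
  rw [integral_angleLaw (by positivity)]
  fin_cases m
  · simp only [Nat.cast_zero, angleDensity_zero]
    rw [intervalIntegral.integral_const_mul, integral_cos_pow_odd, mul_zero]
  · simp only [Nat.cast_one, angleDensity_one]
    have : ∀ θ, 2 / Real.pi * Real.sin θ ^ 2 * Real.cos θ ^ (2 * k + 1) =
        2 / Real.pi * (Real.cos θ ^ (2 * k + 1) - Real.cos θ ^ (2 * (k + 1) + 1)) := fun θ => by
      rw [Real.sin_sq]; ring
    simp_rw [this]
    rw [intervalIntegral.integral_const_mul, intervalIntegral.integral_sub
      (Continuous.intervalIntegrable (by fun_prop) _ _)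
      (Continuous.intervalIntegrable (by fun_prop) _ _), integral_cos_pow_odd, integral_cos_pow_odd]
    simp

lemma angleLaw_zero : angleLaw 0 =
    ENNReal.ofReal (1 / Real.pi) • volume.restrict (Set.Ioo 0 Real.pi) := by
  simp_rw [angleLaw, angleDensity_zero, withDensity_const]

instance : IsProbabilityMeasure (angleLaw 0) := ⟨by
  rw [angleLaw_zero, Measure.smul_apply, Measure.restrict_apply_univ, Real.volume_Ioo, sub_zero,
    smul_eq_mul, ← ENNReal.ofReal_mul (by positivity), one_div_mul_cancel Real.pi_ne_zero,
    ENNReal.ofReal_one]⟩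

lemma image_cos_Ioo (b : ℝ) {r : ℝ} (hr : 0 < r) :
    (fun θ => b + r * Real.cos θ) '' Set.Ioo 0 Real.pi = Set.Ioo (b - r) (b + r) := by
  ext x
  simp only [Set.mem_image, Set.mem_Ioo]
  constructor
  · rintro ⟨θ, hθ, rfl⟩
    have := Real.mapsTo_cos_Ioo hθ
    constructor <;> nlinarith [this.1, this.2]
  · rintro ⟨h1, h2⟩
    have h3 : -1 < (x - b) / r := by rw [lt_div_iff₀ hr]; linarith
    have h4 : (x - b) / r < 1 := by rw [div_lt_iff₀ hr]; linarith
    refine ⟨Real.arccos ((x - b) / r), ⟨Real.arccos_pos.2 h4, ?_⟩, ?_⟩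
    · exact lt_of_le_of_ne (Real.arccos_le_pi _) fun h => by
        rw [Real.arccos_eq_pi] at h; linarith
    · rw [Real.cos_arccos h3.le h4.le]
      field_simp
      ring

/-- The density of `b + r * cos Θ` for a uniform angle `Θ`. -/
theorem map_cos_angleLaw_zero (b : ℝ) {r : ℝ} (hr : 0 < r) :
    (angleLaw 0).map (fun θ => b + r * Real.cos θ) =
      (volume.restrict (Set.Ioo (b - r) (b + r))).withDensity fun x =>
        ENNReal.ofReal (1 / (Real.pi * Real.sqrt (r ^ 2 - (x - b) ^ 2))) := by
  refine Measure.ext_of_lintegral _ fun f hf => ?_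
  rw [lintegral_map hf (by fun_prop), angleLaw_zero, lintegral_smul_measure,
    lintegral_withDensity_eq_lintegral_mul _ (by fun_prop) hf, ← image_cos_Ioo b hr,
    lintegral_image_eq_lintegral_abs_deriv_mul measurableSet_Ioo
      (f' := fun θ => r * -Real.sin θ), smul_eq_mul, ← lintegral_const_mul _ (by fun_prop)]
  · refine setLIntegral_congr_fun measurableSet_Ioo fun θ hθ => ?_
    have hs := Real.sin_pos_of_mem_Ioo hθ
    have h1 : r ^ 2 - (b + r * Real.cos θ - b) ^ 2 = (r * Real.sin θ) ^ 2 := by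
      rw [mul_pow r (Real.sin θ), Real.sin_sq]; ring
    simp only [Pi.mul_apply]
    rw [h1, Real.sqrt_sq (by positivity), ← mul_assoc, ← ENNReal.ofReal_mul (abs_nonneg _),
      mul_neg, abs_neg, abs_of_pos (by positivity)]
    congr 2
    field_simp
  · exact fun θ _ => (((Real.hasDerivAt_cos θ).const_mul r).const_add b).hasDerivWithinAt
  · intro x hx y hy hxy
    have : Real.cos x = Real.cos y := by
      have h : b + r * Real.cos x = b + r * Real.cos y := hxy
      exact mul_left_cancel₀ hr.ne' (add_left_cancel h)
    exact Real.injOn_cos (Set.Ioo_subset_Icc_self hx) (Set.Ioo_subset_Icc_self hy) this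

/-- The arcsine law is an affine image of the cosine of a uniform angle, which gives its total mass
and its moments. -/
lemma arcsineLaw_eq_map {t : ℝ} (ht : 0 < t) :
    arcsineLaw t = (angleLaw 0).map fun θ => t / 2 + t / 2 * Real.cos θ := by
  rw [map_cos_angleLaw_zero _ (half_pos ht), arcsineLaw]
  rw [sub_self, add_halves]
  congr 1
  ext x
  congr 5
  ring

lemma isProbabilityMeasure_arcsineLaw {t : ℝ} (ht : 0 < t) :
    IsProbabilityMeasure (arcsineLaw t) := by
  rw [arcsineLaw_eq_map ht]
  exact Measure.isProbabilityMeasure_map (by fun_prop)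

lemma ae_mem_Ioo_arcsineLaw (t : ℝ) : ∀ᵐ s ∂arcsineLaw t, s ∈ Set.Ioo 0 t :=
  (withDensity_absolutelyContinuous _ _).ae_le (ae_restrict_mem measurableSet_Ioo)

lemma integral_pow_arcsineLaw {t : ℝ} (ht : 0 < t) (r : ℕ) :
    ∫ s, s ^ r ∂arcsineLaw t = t ^ r * arcsineMoment r := by
  rw [arcsineLaw_eq_map ht, integral_map (by fun_prop) (by fun_prop),
    integral_angleLaw le_rfl]
  -- Half-angle formula: `t / 2 * (1 + cos θ) = t * cos (θ / 2) ^ 2`.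
  have : ∀ θ, angleDensity 0 θ * (t / 2 + t / 2 * Real.cos θ) ^ r =
      t ^ r / Real.pi * Real.cos (θ / 2) ^ (2 * r) := fun θ => by
    rw [angleDensity_zero, pow_mul, Real.cos_sq, mul_div_cancel₀ _ two_ne_zero,
      show t / 2 + t / 2 * Real.cos θ = t * (1 / 2 + Real.cos θ / 2) by ring, mul_pow]
    ring
  simp_rw [this]
  rw [intervalIntegral.integral_const_mul,
    intervalIntegral.integral_comp_div (fun x => Real.cos x ^ (2 * r)) two_ne_zero,
    integral_cos_pow_even (by simp) (by simp)]
  have := Real.pi_pos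
  rw [smul_eq_mul]
  field_simp
  ring

end FrictionMotion

/-! ### Riemann sums for the time spent on the positive half-line -/

namespace FrictionMotion

open Filter Topology

/-- The times `(j + 1) * (t / (n + 1))` of a regular subdivision of `[0, t]` at which `b` is
positive. -/
noncomputable def gridCount (t : ℝ) (n : ℕ) (b : ℝ≥0 → ℝ) : ℕ :=
  ∑ j ∈ Finset.range (n + 1), if 0 < b (((j : ℝ) + 1) * (t / (n + 1))).toNNReal then 1 else 0

@[fun_prop]
lemma measurable_gridCount (t : ℝ) (n : ℕ) : Measurable (gridCount t n) := by
  unfold gridCount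
  refine Finset.measurable_fun_sum _ fun j _ => ?_
  exact Measurable.ite (measurableSet_lt measurable_const (measurable_pi_apply _))
    measurable_const measurable_const

lemma gridCount_le (t : ℝ) (n : ℕ) (b : ℝ≥0 → ℝ) : gridCount t n b ≤ n + 1 := by
  unfold gridCount
  refine (Finset.sum_le_card_nsmul _ _ 1 fun j _ => ?_).trans (by simp)
  split_ifs <;> simp

/-- A right-endpoint step approximation of the identity with mesh `δ`. -/
noncomputable def stepUp (δ s : ℝ) : ℝ := (⌈s / δ⌉₊ : ℝ) * δ

lemma stepUp_of_mem {δ : ℝ} (hδ : 0 < δ) {j : ℕ} {s : ℝ} (hs : s ∈ Set.Ioc (j * δ) ((j + 1) * δ)) :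
    stepUp δ s = (j + 1) * δ := by
  have : ⌈s / δ⌉₊ = j + 1 := by
    rw [Nat.ceil_eq_iff (by omega)]
    constructor
    · rw [lt_div_iff₀ hδ]; simpa using hs.1
    · rw [div_le_iff₀ hδ]; exact_mod_cast hs.2
  rw [stepUp, this]; push_cast; rfl

lemma abs_stepUp_sub_le {δ s : ℝ} (hδ : 0 < δ) (hs : 0 ≤ s) : |stepUp δ s - s| ≤ δ := by
  have h1 := Nat.le_ceil (s / δ)
  have h2 := Nat.ceil_lt_add_one (div_nonneg hs hδ.le)
  rw [div_le_iff₀ hδ] at h1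
  have h3 : (⌈s / δ⌉₊ : ℝ) * δ < (s / δ + 1) * δ := mul_lt_mul_of_pos_right h2 hδ
  rw [add_mul, div_mul_cancel₀ _ hδ.ne'] at h3
  rw [stepUp, abs_le]
  constructor <;> linarith

@[fun_prop]
lemma measurable_stepUp (δ : ℝ) : Measurable (stepUp δ) := by
  unfold stepUp
  have : Measurable fun s : ℝ => ((⌈s / δ⌉₊ : ℕ) : ℝ) :=
    measurable_from_nat.comp (Nat.measurable_ceil.comp (measurable_id.div_const δ))
  exact this.mul_const δ

/-- The integrand is constant on each cell, so the Riemann sum is exactly an integral and dominated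
convergence applies to it. Right endpoints make the sample times those of the walk at `1, …, n + 1`.
-/
lemma integral_indicator_stepUp {f : ℝ → ℝ} (hf : Measurable f) {t : ℝ} (ht : 0 < t) (n : ℕ) :
    ∫ s in (0 : ℝ)..t, Set.indicator {s : ℝ | 0 < f (stepUp (t / (n + 1)) s)} 1 s =
      t / (n + 1) * ∑ j ∈ Finset.range (n + 1),
        if 0 < f (((j : ℝ) + 1) * (t / (n + 1))) then 1 else 0 := by
  set δ := t / ((n : ℝ) + 1) with hδdef
  have hδ : 0 < δ := by positivity
  have hm : MeasurableSet {s : ℝ | 0 < f (stepUp δ s)} :=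
    measurableSet_lt measurable_const (hf.comp (measurable_stepUp δ))
  have hint : ∀ a b : ℝ, IntervalIntegrable (Set.indicator {s : ℝ | 0 < f (stepUp δ s)} (1 : ℝ → ℝ))
      volume a b := fun a b => by
    rw [intervalIntegrable_iff]
    exact (integrableOn_const (by simp)).indicator hm
  have hadj := intervalIntegral.sum_integral_adjacent_intervals (μ := volume)
    (f := Set.indicator {s : ℝ | 0 < f (stepUp δ s)} (1 : ℝ → ℝ)) (a := fun j : ℕ => (j : ℝ) * δ)
    (n := n + 1) fun k _ => hint _ _
  have hend : ((n + 1 : ℕ) : ℝ) * δ = t := by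
    rw [hδdef]; push_cast; field_simp
  rw [hend, Nat.cast_zero, zero_mul] at hadj
  rw [← hadj, Finset.mul_sum]
  refine Finset.sum_congr rfl fun j _ => ?_
  have hle : (j : ℝ) * δ ≤ ((j + 1 : ℕ) : ℝ) * δ := by push_cast; nlinarith
  rw [intervalIntegral.integral_of_le hle]
  have hcongr : ∀ s ∈ Set.Ioc ((j : ℝ) * δ) (((j + 1 : ℕ) : ℝ) * δ),
      Set.indicator {s : ℝ | 0 < f (stepUp δ s)} 1 s =
        if 0 < f (((j : ℝ) + 1) * δ) then (1 : ℝ) else 0 := by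
    intro s hs
    push_cast at hs
    simp only [Set.indicator_apply, Set.mem_ofPred_eq, stepUp_of_mem hδ hs, Pi.one_apply]
  rw [setIntegral_congr_fun measurableSet_Ioc hcongr]
  simp only [integral_const, MeasurableSet.univ, measureReal_restrict_apply, Set.univ_inter,
    Real.volume_real_Ioc_of_le hle, smul_eq_mul]
  push_cast
  ring

/-- Riemann sums for the time that a continuous path spends on the positive half-line. -/
lemma tendsto_gridCount {b : ℝ≥0 → ℝ} (hb : Continuous b) {t : ℝ} (ht : 0 < t)
    (h0 : ∀ᵐ s ∂volume.restrict (Set.Ioc 0 t), b s.toNNReal ≠ 0) :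
    Tendsto (fun n : ℕ => t / (n + 1) * (gridCount t n b : ℝ)) atTop
      (𝓝 (∫ s in (0 : ℝ)..t, Set.indicator {s : ℝ | 0 < b s.toNNReal} 1 s)) := by
  set f : ℝ → ℝ := fun s => b s.toNNReal with hfdef
  have hf : Continuous f := hb.comp continuous_real_toNNReal
  have heq : ∀ n : ℕ, t / (n + 1) * (gridCount t n b : ℝ) =
      ∫ s in (0 : ℝ)..t, Set.indicator {s : ℝ | 0 < f (stepUp (t / (n + 1)) s)} 1 s := by
    intro n
    rw [integral_indicator_stepUp hf.measurable ht, gridCount]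
    push_cast
    rfl
  simp_rw [heq]
  refine intervalIntegral.tendsto_integral_filter_of_dominated_convergence (fun _ => 1)
    (Eventually.of_forall fun n => ?_) (Eventually.of_forall fun n => ?_) (by simp) ?_
  · exact (measurable_one.indicator (measurableSet_lt measurable_const
      (hf.measurable.comp (measurable_stepUp _)))).aestronglyMeasurable
  · refine ae_of_all _ fun s _ => ?_
    rw [Set.indicator_apply]
    split_ifs <;> simp
  · rw [Set.uIoc_of_le ht.le, ← ae_restrict_iff' measurableSet_Ioc]
    filter_upwards [h0, ae_restrict_mem measurableSet_Ioc] with s hs hmem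
    have hstep : Tendsto (fun n : ℕ => stepUp (t / (n + 1)) s) atTop (𝓝 s) := by
      rw [tendsto_iff_norm_sub_tendsto_zero]
      refine squeeze_zero (fun _ => norm_nonneg _)
        (fun n => abs_stepUp_sub_le (by positivity) hmem.1.le) ?_
      simpa [div_eq_mul_inv] using
        (tendsto_one_div_add_atTop_nhds_zero_nat (𝕜 := ℝ)).const_mul t
    have hlim : Tendsto (fun n : ℕ => f (stepUp (t / (n + 1)) s)) atTop (𝓝 (f s)) :=
      (hf.tendsto s).comp hstep
    -- At a time where the path is nonzero, the sampled values eventually have its sign, so the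
    -- indicator is eventually constant.
    refine tendsto_const_nhds.congr' ?_
    rcases lt_or_gt_of_ne hs with h | h
    · filter_upwards [hlim.eventually (gt_mem_nhds h)] with n hn
      simp [not_lt.mpr hn.le, h.le]
    · filter_upwards [hlim.eventually (lt_mem_nhds h)] with n hn
      simp [hn, h]

/-- Each factor `N - i` has the same limit as `N` after division by `n + 1`. This converts binomial
moments of the grid count into moments of its limit. -/
lemma tendsto_descFactorial_div_pow {N : ℕ → ℕ} {a : ℝ}
    (h : Tendsto (fun n : ℕ => (N n : ℝ) / (n + 1)) atTop (𝓝 a)) (r : ℕ) :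
    Tendsto (fun n : ℕ => ((N n).descFactorial r : ℝ) / (n + 1) ^ r) atTop (𝓝 (a ^ r)) := by
  have hi : ∀ i : ℕ, Tendsto (fun n : ℕ => ((N n - i : ℕ) : ℝ) / (n + 1)) atTop (𝓝 a) := by
    intro i
    have hlow : Tendsto (fun n : ℕ => (N n : ℝ) / (n + 1) - i * (1 / ((n : ℝ) + 1))) atTop
        (𝓝 (a - i * 0)) :=
      h.sub ((tendsto_one_div_add_atTop_nhds_zero_nat (𝕜 := ℝ)).const_mul (i : ℝ))
    rw [mul_zero, sub_zero] at hlow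
    refine tendsto_of_tendsto_of_tendsto_of_le_of_le hlow h (fun n => ?_) fun n => ?_
    · have : (N n : ℝ) - i ≤ ((N n - i : ℕ) : ℝ) := by
        rw [sub_le_iff_le_add]; exact_mod_cast le_tsub_add
      calc (N n : ℝ) / (n + 1) - i * (1 / ((n : ℝ) + 1)) = ((N n : ℝ) - i) / (n + 1) := by ring
        _ ≤ _ := by gcongr
    · dsimp only
      gcongr
      exact Nat.sub_le _ _
  have := tendsto_finsetProd (Finset.range r) fun i _ => hi i
  simp only [Finset.prod_const, Finset.card_range, Finset.prod_div_distrib] at this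
  simpa [Nat.descFactorial_eq_prod_range] using this

/-! ### Lévy's arcsine law -/

section Brownian

variable {Ω : Type*}

/-- The increments of `B` along the subdivision of mesh `δ`. -/
noncomputable def gridIncrement (B : ℝ≥0 → Ω → ℝ) (δ : ℝ) (ω : Ω) (i : ℕ) : ℝ :=
  B (((i + 1 : ℕ) : ℝ) * δ).toNNReal ω - B ((i : ℝ) * δ).toNNReal ω

lemma walk_gridIncrement (B : ℝ≥0 → Ω → ℝ) (δ : ℝ) (ω : Ω) (j : ℕ) :
    walk (gridIncrement B δ ω) j = B ((j : ℝ) * δ).toNNReal ω - B 0 ω := by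
  rw [walk]
  unfold gridIncrement
  rw [Finset.sum_range_sub (fun i : ℕ => B ((i : ℝ) * δ).toNNReal ω)]
  simp

lemma gridCount_eq_positiveTime {ω : Ω} (h : B 0 ω = 0) (t : ℝ) (n : ℕ) :
    gridCount t n (fun s => B s ω) =
      positiveTime (gridIncrement B (t / (n + 1)) ω) (n + 1) := by
  simp only [gridCount, positiveTime, walk_gridIncrement, h, sub_zero]
  push_cast
  rfl

variable [MeasurableSpace Ω] {P : Measure Ω} {B : ℝ≥0 → Ω → ℝ}

lemma ae_ne_zero (hB : IsBrownianReal B P) {s : ℝ≥0} (hs : 0 < s) : ∀ᵐ ω ∂P, B s ω ≠ 0 := by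
  have := nullSingletonClass_gaussianReal (μ := 0) hs.ne'
  have h := (hB.hasLaw_eval s).ae_iff (p := fun x => x ≠ 0)
    (measurableSet_setOfPred.1 (measurableSet_singleton (0 : ℝ)).compl)
  rw [h, ae_iff]
  simp

lemma ae_ae_ne_zero [IsProbabilityMeasure P] (hBmeas : ∀ s, Measurable (B s))
    (hB : IsBrownianReal B P) (t : ℝ) :
    ∀ᵐ ω ∂P, ∀ᵐ s ∂volume.restrict (Set.Ioc 0 t), B s.toNNReal ω ≠ 0 := by
  -- Fubini needs joint measurability, but paths are continuous only almost surely. Setting them to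
  -- zero on a measurable null set gives a jointly measurable version.
  obtain ⟨G, hGsub, hGmeas, hGnull⟩ := exists_measurable_superset_of_null (ae_iff.1 hB.cont)
  let C : ℝ≥0 → Ω → ℝ := fun s => Gᶜ.indicator (B s)
  have hCmeas : ∀ s, Measurable (C s) := fun s => (hBmeas s).indicator hGmeas.compl
  have hCcont : ∀ ω, Continuous fun s => C s ω := by
    intro ω
    by_cases hω : ω ∈ G
    · simp [C, hω, continuous_const]
    · have : Continuous fun s => B s ω := by
        by_contra h
        exact hω (hGsub h)
      simpa [C, hω] using this
  have hjoint : Measurable fun p : ℝ × Ω => C p.1.toNNReal p.2 :=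
    (measurable_uncurry_of_continuous_of_measurable hCcont hCmeas).comp
      (measurable_real_toNNReal.prodMap measurable_id)
  have hne : ∀ s : ℝ, 0 < s → ∀ᵐ ω ∂P, C s.toNNReal ω ≠ 0 := by
    intro s hs
    have hG : ∀ᵐ ω ∂P, ω ∉ G := by rw [ae_iff]; simpa using hGnull
    filter_upwards [hG, ae_ne_zero hB (Real.toNNReal_pos.2 hs)] with ω h1 h2
    simpa [C, h1] using h2
  have hset : MeasurableSet {p : ℝ × Ω | C p.1.toNNReal p.2 ≠ 0} :=
    (measurableSet_eq_fun hjoint measurable_const).compl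
  have key := (Measure.ae_ae_comm (μ := volume.restrict (Set.Ioc 0 t)) (ν := P)
    (p := fun s ω => C s.toNNReal ω ≠ 0) hset).1 (by
      filter_upwards [ae_restrict_mem measurableSet_Ioc] with s hs using hne s hs.1)
  have hG : ∀ᵐ ω ∂P, ω ∉ G := by rw [ae_iff]; simpa using hGnull
  filter_upwards [key, hG] with ω h1 h2
  filter_upwards [h1] with s hs
  simpa [C, h2] using hs

lemma measurable_gridIncrement (hBmeas : ∀ s, Measurable (B s)) (δ : ℝ) :
    Measurable (gridIncrement B δ) :=
  measurable_pi_lambda _ fun _ => (hBmeas _).sub (hBmeas _)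

lemma map_gridIncrement [IsProbabilityMeasure P] (hBmeas : ∀ s, Measurable (B s))
    (hB : IsBrownianReal B P) {δ : ℝ} (hδ : 0 < δ) :
    P.map (gridIncrement B δ) = Measure.infinitePi fun _ : ℕ => gaussianReal 0 δ.toNNReal := by
  have hmono : Monotone fun i : ℕ => ((i : ℝ) * δ).toNNReal := fun i j hij =>
    Real.toNNReal_mono (by gcongr)
  have hind := hB.hasIndepIncrements.nat hmono
  have hlaw : ∀ i : ℕ, HasLaw (fun ω => gridIncrement B δ ω i) (gaussianReal 0 δ.toNNReal) P := by
    intro i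
    have h := hB.hasLaw_sub (((i + 1 : ℕ) : ℝ) * δ).toNNReal ((i : ℝ) * δ).toNNReal
    have hd : nndist (((((i + 1 : ℕ) : ℝ) * δ).toNNReal : ℝ≥0) : ℝ) (((i : ℝ) * δ).toNNReal : ℝ≥0)
        = δ.toNNReal := by
      rw [← NNReal.coe_inj, coe_nndist, Real.dist_eq, Real.coe_toNNReal _ (by positivity),
        Real.coe_toNNReal _ (by positivity), Real.coe_toNNReal _ hδ.le]
      push_cast
      rw [show ((i : ℝ) + 1) * δ - i * δ = δ by ring, abs_of_pos hδ]
    rw [← hd]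
    exact h
  exact (iIndepFun.hasLaw_infinitePi hlaw hind
    (measurable_gridIncrement hBmeas δ).aemeasurable).map_eq

lemma integral_choose_gridCount [IsProbabilityMeasure P] (hBmeas : ∀ s, Measurable (B s))
    (hB : IsBrownianReal B P) {t : ℝ} (ht : 0 < t) (n r : ℕ) :
    ∫ ω, ((gridCount t n fun s => B s ω).choose r : ℝ) ∂P =
      (n + 1).choose r * arcsineMoment r := by
  have hδ : 0 < t / ((n : ℝ) + 1) := by positivity
  have hmeas := measurable_gridIncrement hBmeas (t / ((n : ℝ) + 1))
  have hmap := map_gridIncrement hBmeas hB hδ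
  have hsymm : (gaussianReal 0 (t / ((n : ℝ) + 1)).toNNReal).map (fun x => -x) =
      gaussianReal 0 (t / ((n : ℝ) + 1)).toNNReal := by rw [gaussianReal_map_neg, neg_zero]
  have h0 : ∀ j, ∀ᵐ x ∂(Measure.infinitePi fun _ : ℕ =>
      gaussianReal 0 (t / ((n : ℝ) + 1)).toNNReal), walk x (j + 1) ≠ 0 := by
    intro j
    have hset : MeasurableSet {x : ℕ → ℝ | walk x (j + 1) ≠ 0} :=
      (measurableSet_eq_fun (measurable_walk _) measurable_const).compl
    rw [← hmap, ae_map_iff hmeas.aemeasurable hset]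
    filter_upwards [hB.eval_zero_ae_eq_zero,
      ae_ne_zero hB (s := (((j + 1 : ℕ) : ℝ) * (t / ((n : ℝ) + 1))).toNNReal)
        (Real.toNNReal_pos.2 (by positivity))] with ω h1 h2
    rwa [walk_gridIncrement, h1, sub_zero]
  have hmeas' : Measurable fun x : ℕ → ℝ => ((positiveTime x (n + 1)).choose r : ℝ) :=
    (measurable_from_nat (f := fun k : ℕ => (k.choose r : ℝ))).comp (measurable_positiveTime _)
  rw [← integral_choose_positiveTime hsymm h0, ← hmap,
    integral_map hmeas.aemeasurable hmeas'.aestronglyMeasurable]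
  refine integral_congr_ae ?_
  filter_upwards [hB.eval_zero_ae_eq_zero] with ω hω
  rw [gridCount_eq_positiveTime hω]

/-- A measurable functional of the path that computes the sojourn time on the positive
half-line. -/
noncomputable def sojournFunctional (t : ℝ) (b : ℝ≥0 → ℝ) : ℝ :=
  limsup (fun n : ℕ => t / (n + 1) * (gridCount t n b : ℝ)) atTop

@[fun_prop]
lemma measurable_sojournFunctional (t : ℝ) : Measurable (sojournFunctional t) :=
  Measurable.limsup fun n =>
    (measurable_from_nat.comp (measurable_gridCount t n)).const_mul _

lemma ae_tendsto_gridCount [IsProbabilityMeasure P] (hBmeas : ∀ s, Measurable (B s))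
    (hB : IsBrownianReal B P) {t : ℝ} (ht : 0 < t) :
    ∀ᵐ ω ∂P, Tendsto (fun n : ℕ => t / (n + 1) * (gridCount t n (fun s => B s ω) : ℝ)) atTop
      (𝓝 (sojournTime B t ω)) := by
  filter_upwards [hB.cont, ae_ae_ne_zero hBmeas hB t] with ω h1 h2
  exact tendsto_gridCount h1 ht h2

/-- A version of the sojourn time that is a measurable function of the whole path: through it the
independence of `B` and the motion passes to the clock. -/
lemma sojournTime_ae_eq [IsProbabilityMeasure P] (hBmeas : ∀ s, Measurable (B s))
    (hB : IsBrownianReal B P) {t : ℝ} (ht : 0 < t) :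
    sojournTime B t =ᵐ[P] fun ω => sojournFunctional t fun s => B s ω := by
  filter_upwards [ae_tendsto_gridCount hBmeas hB ht] with ω hω
  exact hω.limsup_eq.symm

lemma aemeasurable_sojournTime [IsProbabilityMeasure P] (hBmeas : ∀ s, Measurable (B s))
    (hB : IsBrownianReal B P) {t : ℝ} (ht : 0 < t) : AEMeasurable (sojournTime B t) P :=
  ⟨_, (measurable_sojournFunctional t).comp (measurable_pi_lambda _ hBmeas),
    sojournTime_ae_eq hBmeas hB ht⟩

/-- The normalized factorial moments of the grid count have two limits: one by dominated convergence
along the paths, the other by the explicit binomial moments. -/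
lemma integral_sojournTime_pow [IsProbabilityMeasure P] (hBmeas : ∀ s, Measurable (B s))
    (hB : IsBrownianReal B P) {t : ℝ} (ht : 0 < t) (r : ℕ) :
    ∫ ω, sojournTime B t ω ^ r ∂P = t ^ r * arcsineMoment r := by
  have hdesc : ∀ N : ℕ, (N.descFactorial r : ℝ) = r.factorial * N.choose r := fun N => by
    exact_mod_cast Nat.descFactorial_eq_factorial_mul_choose N r
  have hlim1 : Tendsto (fun n : ℕ => ∫ ω, ((gridCount t n fun s => B s ω).descFactorial r : ℝ) /
      (n + 1) ^ r ∂P) atTop (𝓝 (∫ ω, (sojournTime B t ω / t) ^ r ∂P)) := by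
    refine tendsto_integral_of_dominated_convergence (fun _ => 1) (fun n => ?_)
      (integrable_const _) (fun n => ae_of_all _ fun ω => ?_) ?_
    · have : Measurable fun ω => ((gridCount t n fun s => B s ω).descFactorial r : ℝ) :=
        (measurable_from_nat (f := fun k : ℕ => (k.descFactorial r : ℝ))).comp
          ((measurable_gridCount t n).comp (measurable_pi_lambda _ hBmeas))
      exact (this.div_const _).aestronglyMeasurable
    · rw [Real.norm_of_nonneg (by positivity), div_le_one (by positivity)]
      exact_mod_cast (Nat.descFactorial_le_pow _ _).trans
        (Nat.pow_le_pow_left (gridCount_le t n _) r)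
    · filter_upwards [ae_tendsto_gridCount hBmeas hB ht] with ω hω
      refine tendsto_descFactorial_div_pow ?_ r
      refine (hω.div_const t).congr fun n => ?_
      field_simp
  have hlim2 : Tendsto (fun n : ℕ => ∫ ω, ((gridCount t n fun s => B s ω).descFactorial r : ℝ) /
      (n + 1) ^ r ∂P) atTop (𝓝 (1 ^ r * arcsineMoment r)) := by
    have h1 : Tendsto (fun n : ℕ => (((n + 1 : ℕ) : ℝ)) / ((n : ℝ) + 1)) atTop (𝓝 1) := by
      refine tendsto_const_nhds.congr fun n => ?_
      push_cast
      exact (div_self (by positivity)).symm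
    refine ((tendsto_descFactorial_div_pow h1 r).mul_const (arcsineMoment r)).congr fun n => ?_
    rw [integral_div]
    simp_rw [hdesc]
    rw [integral_const_mul, integral_choose_gridCount hBmeas hB ht]
    ring
  have h := tendsto_nhds_unique hlim1 hlim2
  simp_rw [div_pow] at h
  rw [integral_div, one_pow, one_mul, div_eq_iff (by positivity)] at h
  rw [h, mul_comm]

/-- **Lévy's arcsine law.** -/
theorem hasLaw_sojournTime [IsProbabilityMeasure P] (hBmeas : ∀ s, Measurable (B s))
    (hB : IsBrownianReal B P) {t : ℝ} (ht : 0 < t) :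
    HasLaw (sojournTime B t) (arcsineLaw t) P where
  aemeasurable := aemeasurable_sojournTime hBmeas hB ht
  map_eq := by
    have hmeas := aemeasurable_sojournTime hBmeas hB ht
    have := isProbabilityMeasure_arcsineLaw ht
    have := Measure.isProbabilityMeasure_map hmeas
    refine measure_ext_of_moments (R := t) ?_ ?_ fun r => ?_
    · rw [ae_map_iff hmeas (measurableSet_le measurable_abs measurable_const)]
      refine ae_of_all _ fun ω => ?_
      have := intervalIntegral.norm_integral_le_of_norm_le_const (a := 0) (b := t) (C := 1)
        (f := Set.indicator {s : ℝ | 0 < B s.toNNReal ω} (1 : ℝ → ℝ)) fun s _ => by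
          rw [Set.indicator_apply]; split_ifs <;> simp
      simpa [abs_of_pos ht, sojournTime] using this
    · filter_upwards [ae_mem_Ioo_arcsineLaw t] with s hs
      rw [abs_of_pos hs.1]
      exact hs.2.le
    · rw [integral_map hmeas (by fun_prop), integral_sojournTime_pow hBmeas hB ht,
        integral_pow_arcsineLaw ht]

end Brownian

end FrictionMotion

/-! ### Generating functions of the moments of the cosine -/

namespace FrictionMotion

/-- The even moments of `√W` when `W` has the beta law with parameters `1` and `v`. -/
noncomputable def betaMoment (v : ℝ) (k : ℕ) : ℝ :=
  ∏ i ∈ Finset.range k, ((i : ℝ) + 1) / (1 + v + i)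

lemma betaMoment_succ (v : ℝ) (k : ℕ) :
    betaMoment v (k + 1) = betaMoment v k * (((k : ℝ) + 1) / (1 + v + k)) := by
  exact Finset.prod_range_succ _ _

/-- The generating function of the even moments of `cos Θ` when `Θ` has the law `angleLaw m`. -/
noncomputable def cosSeries (m : Fin 2) : PowerSeries ℝ := PowerSeries.mk (cosMoment m)

lemma cosMoment_zero_right (m : Fin 2) : cosMoment m 0 = 1 := by
  simp [cosMoment, arcsineMoment_zero]

lemma constantCoeff_cosSeries_pow (m : Fin 2) (n : ℕ) :
    PowerSeries.coeff 0 (cosSeries m ^ n) = 1 := by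
  simp [cosSeries, cosMoment_zero_right]

open PowerSeries in
-- The differential equation of `(1 - X)^(-1/2)`, used in place of a closed form because it passes
-- to powers.
lemma one_sub_X_mul_derivative_cosSeries_zero :
    (1 - X) * derivative ℝ (cosSeries 0) = C (1 / 2 : ℝ) * cosSeries 0 := by
  ext k
  rw [sub_mul, one_mul, map_sub, coeff_C_mul]
  rcases k with _ | k
  · have := arcsineMoment_succ 0
    simp [coeff_derivative, cosSeries, cosMoment] at this ⊢
    linarith
  · have := arcsineMoment_succ (k + 1)
    rw [coeff_succ_X_mul]
    simp [coeff_derivative, cosSeries, cosMoment] at this ⊢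
    linarith

open PowerSeries in
lemma coeff_cosSeries_zero_pow_succ (n k : ℕ) :
    ((k : ℝ) + 1) * coeff (k + 1) (cosSeries 0 ^ (n + 1)) =
      ((n + 1) / 2 + k) * coeff k (cosSeries 0 ^ (n + 1)) := by
  have h : (1 - X) * derivative ℝ (cosSeries 0 ^ (n + 1)) =
      C (((n : ℝ) + 1) / 2) * cosSeries 0 ^ (n + 1) := by
    have hC : (C (((n : ℝ) + 1) / 2)) = ((n + 1 : ℕ) : PowerSeries ℝ) * C (1 / 2 : ℝ) := by
      rw [← map_natCast (C (R := ℝ)), ← map_mul]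
      congr 1
      push_cast
      ring
    rw [Derivation.leibniz_pow, hC]
    simp only [nsmul_eq_mul, smul_eq_mul, add_tsub_cancel_right]
    linear_combination ((n + 1 : ℕ) : PowerSeries ℝ) * cosSeries 0 ^ n *
      one_sub_X_mul_derivative_cosSeries_zero
  have hk := congrArg (coeff k) h
  rw [sub_mul, one_mul, map_sub, coeff_C_mul, coeff_derivative] at hk
  rcases k with _ | k
  · simp at hk ⊢
    linarith
  · rw [coeff_succ_X_mul, coeff_derivative] at hk
    push_cast at hk ⊢
    linarith

lemma cosMoment_one (k : ℕ) : cosMoment 1 k = catalan k / 4 ^ k := by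
  have : (catalan k : ℝ) * (k + 1) = k.centralBinom := by
    rw [mul_comm]; exact_mod_cast succ_mul_catalan_eq_centralBinom k
  simp only [cosMoment, one_ne_zero, if_false, arcsineMoment]
  rw [← this]
  field_simp

open PowerSeries in
-- The quadratic equation of the Catalan series, rescaled by `1 / 4`.
lemma cosSeries_one_eq : cosSeries 1 = 1 + C (1 / 4 : ℝ) * (X * cosSeries 1 ^ 2) := by
  ext k
  rw [map_add, coeff_C_mul]
  rcases k with _ | k
  · simp [cosSeries, cosMoment_zero_right]
  · rw [coeff_succ_X_mul, sq, coeff_mul]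
    simp only [cosSeries, coeff_mk, coeff_one, cosMoment_one, catalan_succ']
    push_cast
    rw [zero_add, Finset.sum_div, Finset.mul_sum]
    refine Finset.sum_congr rfl fun p hp => ?_
    rw [← Finset.HasAntidiagonal.mem_antidiagonal.mp hp, pow_succ, pow_add]
    field_simp

/-- The coefficients of the powers of the generating function of the Catalan numbers. -/
noncomputable def ballot (n k : ℕ) : ℝ :=
  (n + 1) * (n + 2 * k).factorial / ((n + 1 + k).factorial * k.factorial * 4 ^ k)

lemma ballot_zero_right (n : ℕ) : ballot n 0 = 1 := by
  have h1 : ((n.factorial : ℕ) : ℝ) ≠ 0 := by positivity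
  have h2 : (n : ℝ) + 1 ≠ 0 := by positivity
  simp [ballot, Nat.factorial_succ, div_self (mul_ne_zero h2 h1)]

lemma ballot_zero_succ (k : ℕ) : ballot 0 (k + 1) = 1 / 4 * ballot 1 k := by
  unfold ballot
  rw [show 0 + 2 * (k + 1) = (1 + 2 * k) + 1 by ring, show 0 + 1 + (k + 1) = 1 + 1 + k by ring,
    Nat.factorial_succ (1 + 2 * k), Nat.factorial_succ k, pow_succ]
  push_cast
  field_simp
  ring

lemma ballot_succ_succ (n k : ℕ) :
    ballot (n + 1) (k + 1) = ballot n (k + 1) + 1 / 4 * ballot (n + 2) k := by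
  unfold ballot
  rw [show n + 1 + 2 * (k + 1) = (n + 2 + 2 * k) + 1 by ring,
    show n + 2 * (k + 1) = n + 2 + 2 * k by ring,
    show n + 1 + 1 + (k + 1) = (n + 1 + 1 + k) + 1 by ring,
    show n + 1 + (k + 1) = n + 1 + 1 + k by ring,
    show n + 2 + 1 + k = (n + 1 + 1 + k) + 1 by ring,
    Nat.factorial_succ (n + 2 + 2 * k), Nat.factorial_succ (n + 1 + 1 + k), Nat.factorial_succ k,
    pow_succ]
  push_cast
  field_simp
  ring

open PowerSeries in
-- Multiplying the quadratic equation by a power of the series gives the recurrence satisfied by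
-- `ballot`. It lowers either the degree or the exponent, hence the nested induction.
lemma coeff_cosSeries_one_pow (n k : ℕ) : coeff k (cosSeries 1 ^ (n + 1)) = ballot n k := by
  induction k generalizing n with
  | zero => rw [constantCoeff_cosSeries_pow, ballot_zero_right]
  | succ k ih =>
    have hpow : ∀ j : ℕ, cosSeries 1 ^ (j + 1) =
        cosSeries 1 ^ j + C (1 / 4 : ℝ) * (X * cosSeries 1 ^ (j + 2)) := fun j => by
      linear_combination cosSeries 1 ^ j * cosSeries_one_eq
    induction n with
    | zero =>
      rw [hpow 0, map_add, coeff_C_mul, coeff_succ_X_mul, ih 1, ballot_zero_succ]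
      simp [coeff_one]
    | succ n ihn =>
      rw [hpow (n + 1), map_add, coeff_C_mul, coeff_succ_X_mul, ihn, ih (n + 2), ballot_succ_succ]

lemma ballot_succ_right (n k : ℕ) :
    (4 * (k + 1) * (n + 2 + k)) * ballot n (k + 1) =
      ((n : ℝ) + 2 * k + 1) * (n + 2 * k + 2) * ballot n k := by
  unfold ballot
  rw [show n + 2 * (k + 1) = (n + 2 * k + 1) + 1 by ring,
    show n + 1 + (k + 1) = (n + 1 + k) + 1 by ring,
    Nat.factorial_succ (n + 2 * k + 1), Nat.factorial_succ (n + 2 * k),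
    Nat.factorial_succ (n + 1 + k), Nat.factorial_succ k, pow_succ]
  push_cast
  field_simp
  ring

lemma shape_nonneg (m : Fin 2) (n : ℕ) : 0 ≤ shape m n := by
  unfold shape; split_ifs <;> positivity

lemma shape_pos (m : Fin 2) {n : ℕ} (hn : 1 ≤ n) : 0 < shape m n := by
  have : (0 : ℝ) < n := by exact_mod_cast hn
  unfold shape; split_ifs <;> positivity

/-- The parameters `n / 2` and `n + 1` originate here: they put both recurrences in one form. For `m
= 0` a factor `4 * (1 + n / 2 + k) = 2 * (n + 2 * k + 2)` is inserted on both sides. -/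
lemma coeff_cosSeries_pow_succ (m : Fin 2) (n k : ℕ) :
    (4 * (k + 1) * (1 + shape m n + k)) * PowerSeries.coeff (k + 1) (cosSeries m ^ (n + 1)) =
      ((n : ℝ) + 2 * k + 1) * (n + 2 * k + 2) * PowerSeries.coeff k (cosSeries m ^ (n + 1)) := by
  fin_cases m
  · have := coeff_cosSeries_zero_pow_succ n k
    simp only [Fin.zero_eta, shape, if_true]
    linear_combination (4 * (1 + (n : ℝ) / 2 + k)) * this
  · have := ballot_succ_right n k
    simp only [Fin.mk_one, shape, one_ne_zero, if_false, coeff_cosSeries_one_pow]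
    linear_combination this

/-- The moments of `√W * cos Θ` are those of a Dirichlet mean of independent cosines. -/
theorem betaMoment_mul_arcsineMoment (m : Fin 2) (n k : ℕ) :
    betaMoment (shape m n) k * arcsineMoment k =
      (2 * k).factorial * n.factorial / (n + 2 * k).factorial *
        PowerSeries.coeff k (cosSeries m ^ (n + 1)) := by
  induction k with
  | zero =>
    rw [constantCoeff_cosSeries_pow, arcsineMoment_zero]
    have : ((n.factorial : ℕ) : ℝ) ≠ 0 := by positivity
    simp [betaMoment, div_self this]
  | succ k ih =>
    have hv := shape_nonneg m n
    have hne : (4 * ((k : ℝ) + 1) * (1 + shape m n + k)) ≠ 0 := by positivity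
    have h1 := coeff_cosSeries_pow_succ m n k
    have h1' : PowerSeries.coeff (k + 1) (cosSeries m ^ (n + 1)) =
        ((n : ℝ) + 2 * k + 1) * (n + 2 * k + 2) * PowerSeries.coeff k (cosSeries m ^ (n + 1)) /
          (4 * (k + 1) * (1 + shape m n + k)) := by
      rw [eq_div_iff hne, mul_comm, h1]
    have h2 : arcsineMoment (k + 1) = (k + 1 / 2) / (k + 1) * arcsineMoment k := by
      have := arcsineMoment_succ k
      field_simp
      linarith
    have h3 : betaMoment (shape m n) (k + 1) * arcsineMoment (k + 1) =
        (betaMoment (shape m n) k * arcsineMoment k) * ((k + 1 / 2) / (1 + shape m n + k)) := by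
      rw [betaMoment_succ, h2]
      field_simp
    rw [h3, ih, h1', show 2 * (k + 1) = 2 * k + 1 + 1 by ring,
      show n + (2 * k + 1 + 1) = n + 2 * k + 1 + 1 by ring,
      Nat.factorial_succ (2 * k + 1), Nat.factorial_succ (2 * k),
      Nat.factorial_succ (n + 2 * k + 1), Nat.factorial_succ (n + 2 * k)]
    push_cast
    field_simp
    ring

/-! ### The motion as a function of waiting times and angles -/

lemma map_prod_prod_comm {α β γ δ : Type*} [MeasurableSpace α] [MeasurableSpace β]
    [MeasurableSpace γ] [MeasurableSpace δ] (μ : Measure α) (ν : Measure β) (ρ : Measure γ)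
    (σ : Measure δ) [SFinite μ] [SFinite ν] [SFinite ρ] [SFinite σ] :
    ((μ.prod ν).prod (ρ.prod σ)).map (fun p => ((p.1.1, p.2.1), (p.1.2, p.2.2))) =
      (μ.prod ρ).prod (ν.prod σ) := by
  refine Measure.ext_of_lintegral _ fun f hf => ?_
  rw [lintegral_map hf (by fun_prop), lintegral_prod _ (by fun_prop), lintegral_prod _ (by fun_prop),
    lintegral_prod _ (by fun_prop), lintegral_prod _ (by fun_prop)]
  refine lintegral_congr fun a => ?_
  have h1 : ∀ b, ∫⁻ q : γ × δ, f ((a, q.1), (b, q.2)) ∂ρ.prod σ =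
      ∫⁻ c, ∫⁻ d, f ((a, c), (b, d)) ∂σ ∂ρ := fun b => lintegral_prod _ (by fun_prop)
  have h2 : ∀ c, ∫⁻ q : β × δ, f ((a, c), q) ∂ν.prod σ =
      ∫⁻ b, ∫⁻ d, f ((a, c), (b, d)) ∂σ ∂ν := fun c => lintegral_prod _ (by fun_prop)
  simp only [h1, h2]
  exact lintegral_lintegral_swap (by fun_prop)

/-- The joint law of the waiting times and of the angles. -/
noncomputable def inputLaw (lam : ℝ) (α : Measure ℝ) : Measure ((ℕ → ℝ) × (ℕ → ℝ)) :=
  (Measure.infinitePi fun _ : ℕ => expMeasure lam).prod (Measure.infinitePi fun _ : ℕ => α)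

/-- The first waiting time and angle, and the remaining ones. -/
def splitInput (z : (ℕ → ℝ) × (ℕ → ℝ)) : (ℝ × ℝ) × ((ℕ → ℝ) × (ℕ → ℝ)) :=
  ((z.1 0, z.2 0), (fun i => z.1 (1 + i), fun i => z.2 (1 + i)))

/-- Exactly `n` events occur in `(0, s]` when the waiting times are `e`. -/
def EventsAt (n : ℕ) (s : ℝ) (e : ℕ → ℝ) : Prop := walk e n ≤ s ∧ s < walk e (n + 1)

/-- The position at time `s` after `n` changes of velocity, for a particle of unit speed. -/
noncomputable def legSum (n : ℕ) (s : ℝ) (z : (ℕ → ℝ) × (ℕ → ℝ)) : ℝ :=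
  ∑ j ∈ Finset.range n, z.1 j * Real.cos (z.2 j) + (s - walk z.1 n) * Real.cos (z.2 n)

lemma eventsAt_succ (n : ℕ) (s : ℝ) (e : ℕ → ℝ) :
    EventsAt (n + 1) s e ↔ EventsAt n (s - e 0) fun i => e (1 + i) := by
  have h : walk e 1 = e 0 := by simp [walk]
  have hw : ∀ j, walk (fun i => e (1 + i)) j = walk e (j + 1) - e 0 := fun j => by
    rw [walk_shift, h, add_comm]
  simp only [EventsAt, hw]
  constructor <;> rintro ⟨h1, h2⟩ <;> constructor <;> linarith

/-- Renewal at the first event: after the first leg, the same motion runs on the shifted input for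
the remaining time. -/
lemma legSum_succ (n : ℕ) (s : ℝ) (z : (ℕ → ℝ) × (ℕ → ℝ)) :
    legSum (n + 1) s z = z.1 0 * Real.cos (z.2 0) +
      legSum n (s - z.1 0) (splitInput z).2 := by
  have h : walk z.1 1 = z.1 0 := by simp [walk]
  have hw : walk (fun i => z.1 (1 + i)) n = walk z.1 (n + 1) - z.1 0 := by
    rw [walk_shift, h, add_comm]
  simp only [legSum, splitInput, hw]
  simp only [Finset.sum_range_succ', add_comm 1]
  ring

lemma walk_nonneg {e : ℕ → ℝ} (he : ∀ i, 0 < e i) (n : ℕ) : 0 ≤ walk e n :=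
  Finset.sum_nonneg fun i _ => (he i).le

lemma abs_legSum_le {e y : ℕ → ℝ} (he : ∀ i, 0 < e i) {n : ℕ} {s : ℝ} (h : EventsAt n s e) :
    |legSum n s (e, y)| ≤ s := by
  have hs : 0 ≤ s - walk e n := sub_nonneg.2 h.1
  calc |legSum n s (e, y)|
      ≤ ∑ j ∈ Finset.range n, |e j * Real.cos (y j)| + |(s - walk e n) * Real.cos (y n)| :=
        (abs_add_le _ _).trans (add_le_add_left (Finset.abs_sum_le_sum_abs _ _) _)
    _ ≤ ∑ j ∈ Finset.range n, e j + (s - walk e n) := by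
        refine add_le_add (Finset.sum_le_sum fun j _ => ?_) ?_
        · rw [abs_mul, abs_of_pos (he j)]
          exact mul_le_of_le_one_right (he j).le (Real.abs_cos_le_one _)
        · rw [abs_mul, abs_of_nonneg hs]
          exact mul_le_of_le_one_right hs (Real.abs_cos_le_one _)
    _ = s := by rw [walk]; ring

@[fun_prop]
lemma measurable_legSum (n : ℕ) : Measurable fun p : ℝ × ((ℕ → ℝ) × (ℕ → ℝ)) =>
    legSum n p.1 p.2 := by
  unfold legSum walk; fun_prop

lemma measurableSet_eventsAt (n : ℕ) :
    MeasurableSet {p : ℝ × ((ℕ → ℝ) × (ℕ → ℝ)) | EventsAt n p.1 p.2.1} :=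
  (measurableSet_le (by unfold walk; fun_prop) measurable_fst).inter
    (measurableSet_lt measurable_fst (by unfold walk; fun_prop))

lemma measurableSet_eventsAt_right (n : ℕ) (s : ℝ) :
    MeasurableSet {z : (ℕ → ℝ) × (ℕ → ℝ) | EventsAt n s z.1} :=
  (measurable_const.prodMk measurable_id) (measurableSet_eventsAt n)

section exponential

variable {lam : ℝ}

lemma expMeasure_eq (lam : ℝ) : expMeasure lam = (volume.restrict (Set.Ici 0)).withDensity
    fun r => ENNReal.ofReal (lam * Real.exp (-(lam * r))) := by
  rw [← withDensity_indicator measurableSet_Ici, expMeasure, gammaMeasure]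
  congr 1
  ext r
  rw [gammaPDF, gammaPDFReal, Set.indicator_apply]
  simp only [Set.mem_Ici]
  split_ifs <;> simp

lemma ae_pos_expMeasure (lam : ℝ) : ∀ᵐ r ∂expMeasure lam, 0 < r := by
  rw [expMeasure_eq]
  refine (withDensity_absolutelyContinuous _ _).ae_le ?_
  rw [Measure.restrict_congr_set Ioi_ae_eq_Ici.symm]
  exact ae_restrict_mem measurableSet_Ioi

lemma integral_expMeasure_indicator (hlam : 0 < lam) {s : ℝ} (hs : 0 ≤ s) (k : ℝ → ℝ) :
    ∫ r, (Set.Iic s).indicator k r ∂expMeasure lam =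
      ∫ r in (0 : ℝ)..s, lam * Real.exp (-(lam * r)) * k r := by
  rw [expMeasure_eq, integral_withDensity_eq_integral_toReal_smul (by fun_prop) (by simp),
    intervalIntegral.integral_of_le hs, ← integral_Icc_eq_integral_Ioc,
    ← Set.Ici_inter_Iic, Set.inter_comm, ← Measure.restrict_restrict measurableSet_Iic,
    ← integral_indicator measurableSet_Iic]
  refine integral_congr_ae (ae_of_all _ fun r => ?_)
  by_cases hr : r ∈ Set.Iic s
  · simp only [hr, Set.indicator_of_mem, smul_eq_mul]
    rw [ENNReal.toReal_ofReal (by positivity)]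
  · simp [hr]

/-- Euler's Beta integral at integer exponents, by integration by parts; it integrates out the first
waiting time. -/
lemma integral_pow_mul_sub_pow (a b : ℕ) (s : ℝ) :
    ∫ r in (0 : ℝ)..s, r ^ a * (s - r) ^ b =
      a.factorial * b.factorial / (a + b + 1).factorial * s ^ (a + b + 1) := by
  induction a generalizing b with
  | zero =>
    simp only [pow_zero, one_mul, Nat.factorial_zero, Nat.cast_one, zero_add]
    rw [intervalIntegral.integral_comp_sub_left (fun x => x ^ b), integral_pow,
      Nat.factorial_succ]
    have : ((b.factorial : ℕ) : ℝ) ≠ 0 := by positivity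
    push_cast
    simp
    field_simp
  | succ a ih =>
    have hderiv : ∀ r : ℝ, HasDerivAt (fun r : ℝ => r ^ (a + 1) * (s - r) ^ (b + 1))
        (((a : ℝ) + 1) * (r ^ a * (s - r) ^ (b + 1)) -
          (b + 1) * (r ^ (a + 1) * (s - r) ^ b)) r := by
      intro r
      have h1 := (hasDerivAt_id r).pow (a + 1)
      have h2 := ((hasDerivAt_id r).const_sub s).pow (b + 1)
      refine (h1.mul h2).congr_deriv ?_
      simp
      ring
    have hftc := intervalIntegral.integral_eq_sub_of_hasDerivAt (a := 0) (b := s)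
      (fun r _ => hderiv r) (Continuous.intervalIntegrable (by fun_prop) _ _)
    rw [intervalIntegral.integral_sub (Continuous.intervalIntegrable (by fun_prop) _ _)
      (Continuous.intervalIntegrable (by fun_prop) _ _), intervalIntegral.integral_const_mul,
      intervalIntegral.integral_const_mul, ih (b + 1)] at hftc
    simp only [sub_self, ne_eq, Nat.add_eq_zero_iff, one_ne_zero, and_false, not_false_eq_true,
      zero_pow, mul_zero, zero_mul] at hftc
    have hb : (b : ℝ) + 1 ≠ 0 := by positivity
    apply mul_left_cancel₀ hb
    rw [show a + 1 + b + 1 = a + (b + 1) + 1 by ring, Nat.factorial_succ a]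
    rw [Nat.factorial_succ b] at hftc
    push_cast at hftc ⊢
    linear_combination -hftc

end exponential

/-! ### Moments of the position on the event of `n` changes -/

section moments

variable {lam : ℝ} {α : Measure ℝ}

/-- Coefficients of the powers of the generating function of the moments of `cos θ`, `θ ∼ α`. -/
noncomputable def legMoment (α : Measure ℝ) : ℕ → ℕ → ℝ
  | 0, p => ∫ θ, Real.cos θ ^ p ∂α
  | n + 1, p => ∑ q ∈ Finset.range (p + 1),
      (∫ θ, Real.cos θ ^ q ∂α) * legMoment α n (p - q)

/-- The moments of the position at time `s`, on the event that `n` changes of velocity occurred. -/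
noncomputable def legFormula (lam : ℝ) (α : Measure ℝ) (n p : ℕ) (s : ℝ) : ℝ :=
  Real.exp (-(lam * s)) * lam ^ n * s ^ (n + p) * (p.factorial / (n + p).factorial) *
    legMoment α n p

lemma continuous_legFormula (n p : ℕ) : Continuous (legFormula lam α n p) := by
  unfold legFormula; fun_prop

/-- The closed form solves the renewal equation: the exponentials combine to `exp (-(lam * s))`, and
the factorials of the remaining Beta integral cancel against the binomial coefficient. -/
lemma legFormula_succ (n p : ℕ) {s : ℝ} (hlam : 0 < lam) (hs : 0 ≤ s) :
    ∑ q ∈ Finset.range (p + 1), (p.choose q : ℝ) *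
      ((∫ r, (Set.Iic s).indicator (fun r => r ^ q * legFormula lam α n (p - q) (s - r)) r
        ∂expMeasure lam) * ∫ θ, Real.cos θ ^ q ∂α) = legFormula lam α (n + 1) p s := by
  rw [legFormula, legMoment, Finset.mul_sum]
  refine Finset.sum_congr rfl fun q hq => ?_
  obtain ⟨d, rfl⟩ := Nat.exists_eq_add_of_le (show q ≤ p by simpa [Nat.lt_succ_iff] using hq)
  rw [integral_expMeasure_indicator hlam hs, Nat.add_sub_cancel_left]
  have hcongr : ∀ r : ℝ, lam * Real.exp (-(lam * r)) * (r ^ q * legFormula lam α n d (s - r)) =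
      (lam ^ (n + 1) * Real.exp (-(lam * s)) * (d.factorial / (n + d).factorial) *
        legMoment α n d) * (r ^ q * (s - r) ^ (n + d)) := by
    intro r
    have hexp : Real.exp (-(lam * s)) = Real.exp (-(lam * r)) * Real.exp (-(lam * (s - r))) := by
      rw [← Real.exp_add]; congr 1; ring
    rw [legFormula, hexp]
    ring
  simp_rw [hcongr]
  rw [intervalIntegral.integral_const_mul, integral_pow_mul_sub_pow,
    show n + 1 + (q + d) = q + (n + d) + 1 by ring]
  have hchoose : ((q + d).choose q : ℝ) * q.factorial * d.factorial = (q + d).factorial := by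
    rw [Nat.choose_symm_add]
    exact_mod_cast Nat.add_choose_mul_factorial_mul_factorial q d
  have h1 : (((n + d).factorial : ℕ) : ℝ) ≠ 0 := by positivity
  have h2 : (((q + (n + d) + 1).factorial : ℕ) : ℝ) ≠ 0 := by positivity
  rw [← hchoose]
  field_simp

variable [IsProbabilityMeasure α]

lemma legMoment_zero_right (n : ℕ) : legMoment α n 0 = 1 := by
  induction n with
  | zero => simp [legMoment]
  | succ n ih => simp [legMoment, ih]

lemma isProbabilityMeasure_inputLaw (hlam : 0 < lam) : IsProbabilityMeasure (inputLaw lam α) := by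
  have := isProbabilityMeasure_expMeasure hlam
  unfold inputLaw
  infer_instance

lemma measurePreserving_splitInput (hlam : 0 < lam) :
    MeasurePreserving splitInput (inputLaw lam α)
      (((expMeasure lam).prod α).prod (inputLaw lam α)) where
  measurable := by unfold splitInput; fun_prop
  map_eq := by
    have := isProbabilityMeasure_expMeasure hlam
    let h : (ℕ → ℝ) → ℝ × (ℕ → ℝ) := fun x => (x 0, fun i => x (1 + i))
    have hh : Measurable h := by fun_prop
    have hm := (map_prod_prod_comm (expMeasure lam) (Measure.infinitePi fun _ : ℕ => expMeasure lam)
      α (Measure.infinitePi fun _ : ℕ => α))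
    rw [← map_head_tail_infinitePi, ← map_head_tail_infinitePi,
      Measure.map_prod_map _ _ hh hh, Measure.map_map (by fun_prop) (by fun_prop)] at hm
    exact hm

lemma ae_pos_inputLaw (hlam : 0 < lam) : ∀ᵐ z ∂inputLaw lam α, ∀ i, 0 < z.1 i := by
  have := isProbabilityMeasure_expMeasure hlam
  rw [ae_all_iff]
  intro i
  have h : (inputLaw lam α).map (fun z => z.1 i) = expMeasure lam := by
    have : (fun z : (ℕ → ℝ) × (ℕ → ℝ) => z.1 i) = (fun x => x i) ∘ Prod.fst := rfl
    rw [this, ← Measure.map_map (by fun_prop) (by fun_prop), inputLaw, Measure.map_fst_prod]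
    simp [Measure.infinitePi_map_eval]
  have h2 := ae_pos_expMeasure lam
  rw [← h] at h2
  exact ae_of_ae_map (by fun_prop) h2

/-- The truncated powers of the position. -/
noncomputable def legPow (n p : ℕ) (s : ℝ) (z : (ℕ → ℝ) × (ℕ → ℝ)) : ℝ :=
  {z : (ℕ → ℝ) × (ℕ → ℝ) | EventsAt n s z.1}.indicator (fun z => legSum n s z ^ p) z

lemma measurable_legPow (n p : ℕ) : Measurable fun q : ℝ × ((ℕ → ℝ) × (ℕ → ℝ)) =>
    legPow n p q.1 q.2 := by
  have : (fun q : ℝ × ((ℕ → ℝ) × (ℕ → ℝ)) => legPow n p q.1 q.2) =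
      {q : ℝ × ((ℕ → ℝ) × (ℕ → ℝ)) | EventsAt n q.1 q.2.1}.indicator
        fun q => legSum n q.1 q.2 ^ p := rfl
  rw [this]
  exact ((measurable_legSum n).pow_const p).indicator (measurableSet_eventsAt n)

lemma abs_legPow_le {z : (ℕ → ℝ) × (ℕ → ℝ)} (hz : ∀ i, 0 < z.1 i) (n p : ℕ) (s : ℝ) :
    |legPow n p s z| ≤ |s| ^ p := by
  unfold legPow
  by_cases h : EventsAt n s z.1
  · rw [Set.indicator_of_mem (by exact h), abs_pow]
    exact pow_le_pow_left₀ (abs_nonneg _) ((abs_legSum_le hz h).trans (le_abs_self s)) p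
  · rw [Set.indicator_of_notMem (by exact h), abs_zero]; positivity

lemma integrable_legPow (hlam : 0 < lam) (n p : ℕ) (s : ℝ) :
    Integrable (legPow n p s) (inputLaw lam α) := by
  have := isProbabilityMeasure_inputLaw (α := α) hlam
  refine Integrable.of_bound ((measurable_legPow n p).comp
    (measurable_const.prodMk measurable_id)).aestronglyMeasurable (|s| ^ p) ?_
  filter_upwards [ae_pos_inputLaw hlam] with z hz using abs_legPow_le hz n p s

/-- In the renewal step the remaining time is negative when the first wait exceeds `s`; such waits
contribute nothing. -/
lemma integral_legPow_of_neg (hlam : 0 < lam) (n p : ℕ) {s : ℝ} (hs : s < 0) :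
    ∫ z, legPow n p s z ∂inputLaw lam α = 0 := by
  refine integral_eq_zero_of_ae ?_
  filter_upwards [ae_pos_inputLaw hlam] with z hz
  refine Set.indicator_of_notMem (fun h => ?_) _
  exact absurd ((walk_nonneg hz n).trans h.1) (not_le.2 hs)

lemma legPow_succ (n p : ℕ) (s : ℝ) (z : (ℕ → ℝ) × (ℕ → ℝ)) :
    legPow (n + 1) p s z = ∑ q ∈ Finset.range (p + 1), (p.choose q : ℝ) *
      ((z.1 0 * Real.cos (z.2 0)) ^ q * legPow n (p - q) (s - z.1 0) (splitInput z).2) := by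
  unfold legPow
  by_cases h : EventsAt n (s - z.1 0) (splitInput z).2.1
  · rw [Set.indicator_of_mem (by exact (eventsAt_succ n s z.1).2 h), legSum_succ, add_pow]
    refine Finset.sum_congr rfl fun q _ => ?_
    rw [Set.indicator_of_mem (by exact h)]
    ring
  · rw [Set.indicator_of_notMem (by exact fun h' => h ((eventsAt_succ n s z.1).1 h'))]
    symm
    refine Finset.sum_eq_zero fun q _ => ?_
    rw [Set.indicator_of_notMem (by exact h), mul_zero, mul_zero]

lemma integrable_indicator_expMeasure (hlam : 0 < lam) {k : ℝ → ℝ} (hk : Continuous k) (s : ℝ) :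
    Integrable ((Set.Iic s).indicator k) (expMeasure lam) := by
  have := isProbabilityMeasure_expMeasure hlam
  obtain ⟨C, hC⟩ := (isCompact_Icc (a := (0 : ℝ)) (b := s)).exists_bound_of_continuousOn
    hk.continuousOn
  refine Integrable.of_bound (hk.measurable.indicator measurableSet_Iic).aestronglyMeasurable
    (max C 0) ?_
  filter_upwards [ae_pos_expMeasure lam] with r hr
  by_cases hrs : r ∈ Set.Iic s
  · rw [Set.indicator_of_mem hrs]
    exact (hC r ⟨hr.le, hrs⟩).trans (le_max_left _ _)
  · rw [Set.indicator_of_notMem hrs, norm_zero]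
    exact le_max_right _ _

lemma measureReal_Ioi_expMeasure (hlam : 0 < lam) {s : ℝ} (hs : 0 ≤ s) :
    (expMeasure lam).real (Set.Ioi s) = Real.exp (-(lam * s)) := by
  have := isProbabilityMeasure_expMeasure hlam
  have h := cdf_expMeasure_eq hlam s
  rw [if_pos hs, cdf_eq_real] at h
  rw [← Set.compl_Iic, measureReal_compl measurableSet_Iic, h, probReal_univ]
  ring

lemma integral_legPow_zero (hlam : 0 < lam) (p : ℕ) {s : ℝ} (hs : 0 ≤ s) :
    ∫ z, legPow 0 p s z ∂inputLaw lam α = legFormula lam α 0 p s := by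
  have := isProbabilityMeasure_expMeasure hlam
  have := isProbabilityMeasure_inputLaw (α := α) hlam
  have hmp := measurePreserving_splitInput (α := α) hlam
  let f : ℝ × ℝ → ℝ := fun x => (Set.Ioi s).indicator (fun _ => s ^ p) x.1 * Real.cos x.2 ^ p
  have hf : Measurable f :=
    ((measurable_const.indicator measurableSet_Ioi).comp measurable_fst).mul (by fun_prop)
  have heq : ∀ z, legPow 0 p s z = f (splitInput z).1 := by
    intro z
    have h1 : walk z.1 1 = z.1 0 := by simp [walk]
    by_cases h : s < z.1 0
    · have he : EventsAt 0 s z.1 := ⟨by rwa [walk_zero], by rwa [zero_add, h1]⟩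
      unfold legPow
      rw [Set.indicator_of_mem (by exact he)]
      simp [legSum, walk_zero, f, splitInput, Set.indicator_of_mem (show z.1 0 ∈ Set.Ioi s from h),
        mul_pow]
    · have he : ¬ EventsAt 0 s z.1 := fun he => h (by have := he.2; rwa [zero_add, h1] at this)
      unfold legPow
      rw [Set.indicator_of_notMem (by exact he)]
      simp [f, splitInput, h]
  have hfst : (inputLaw lam α).map (fun z => (splitInput z).1) = (expMeasure lam).prod α := by
    have : (fun z => (splitInput z).1) = Prod.fst ∘ splitInput := rfl
    rw [this, ← Measure.map_map measurable_fst hmp.measurable, hmp.map_eq, Measure.map_fst_prod]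
    simp
  simp_rw [heq]
  rw [← integral_map (φ := fun z => (splitInput z).1) (f := f)
    (measurable_fst.comp hmp.measurable).aemeasurable hf.aestronglyMeasurable, hfst]
  simp only [f]
  rw [integral_prod_mul ((Set.Ioi s).indicator fun _ => s ^ p) (fun θ => Real.cos θ ^ p),
    integral_indicator_const _ measurableSet_Ioi,
    measureReal_Ioi_expMeasure hlam hs]
  have : ((p.factorial : ℕ) : ℝ) ≠ 0 := by positivity
  simp [legFormula, legMoment, this]

/-- Expand by the binomial theorem at the first event. The first wait, the first angle and the
shifted input are independent, so Fubini reduces the moment to the renewal equation solved by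
`legFormula`. -/
theorem integral_legPow (hlam : 0 < lam) (n p : ℕ) {s : ℝ} (hs : 0 ≤ s) :
    ∫ z, legPow n p s z ∂inputLaw lam α = legFormula lam α n p s := by
  have := isProbabilityMeasure_expMeasure hlam
  have := isProbabilityMeasure_inputLaw (α := α) hlam
  induction n generalizing p s with
  | zero => exact integral_legPow_zero hlam p hs
  | succ n ih =>
    have hmp := measurePreserving_splitInput (α := α) hlam
    let G : (ℝ × ℝ) × ((ℕ → ℝ) × (ℕ → ℝ)) → ℝ := fun x => ∑ q ∈ Finset.range (p + 1),
      (p.choose q : ℝ) * ((x.1.1 * Real.cos x.1.2) ^ q * legPow n (p - q) (s - x.1.1) x.2)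
    have hG : Measurable G := by
      refine Finset.measurable_fun_sum _ fun q _ => ?_
      refine Measurable.const_mul (Measurable.mul (by fun_prop) ?_) _
      exact (measurable_legPow n (p - q)).comp
        ((by fun_prop : Measurable fun x : (ℝ × ℝ) × ((ℕ → ℝ) × (ℕ → ℝ)) => (s - x.1.1, x.2)))
    have heq : ∀ z, legPow (n + 1) p s z = G (splitInput z) := fun z => legPow_succ n p s z
    have hint : Integrable G (((expMeasure lam).prod α).prod (inputLaw lam α)) := by
      rw [← hmp.map_eq, integrable_map_measure hG.aestronglyMeasurable hmp.measurable.aemeasurable]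
      exact (integrable_legPow hlam (n + 1) p s).congr (ae_of_all _ heq)
    simp_rw [heq]
    rw [← integral_map hmp.measurable.aemeasurable hG.aestronglyMeasurable, hmp.map_eq,
      integral_prod _ hint, ← legFormula_succ n p hlam hs]
    have hinner : ∀ x : ℝ × ℝ, ∫ w, G (x, w) ∂inputLaw lam α =
        ∑ q ∈ Finset.range (p + 1), (p.choose q : ℝ) *
          ((Set.Iic s).indicator (fun r => r ^ q * legFormula lam α n (p - q) (s - r)) x.1 *
            Real.cos x.2 ^ q) := by
      intro x
      simp only [G]
      rw [integral_finsetSum _ fun q _ =>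
        ((integrable_legPow hlam n (p - q) (s - x.1)).const_mul _).const_mul _]
      refine Finset.sum_congr rfl fun q _ => ?_
      rw [integral_const_mul, integral_const_mul]
      by_cases hx : x.1 ∈ Set.Iic s
      · rw [Set.indicator_of_mem hx, ih (p - q) (sub_nonneg.2 hx)]
        ring
      · rw [Set.indicator_of_notMem hx, integral_legPow_of_neg hlam n _
          (sub_neg.2 (not_le.1 hx))]
        ring
    simp_rw [hinner]
    have hcos : ∀ q : ℕ, Integrable (fun θ => Real.cos θ ^ q) α := fun q =>
      Integrable.of_bound (by fun_prop) 1 (ae_of_all _ fun θ => by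
        rw [norm_pow]
        exact pow_le_one₀ (norm_nonneg _) (Real.abs_cos_le_one θ))
    have hterm : ∀ q : ℕ, Integrable (fun x : ℝ × ℝ => (p.choose q : ℝ) *
        ((Set.Iic s).indicator (fun r => r ^ q * legFormula lam α n (p - q) (s - r)) x.1 *
          Real.cos x.2 ^ q)) ((expMeasure lam).prod α) := fun q =>
      ((integrable_indicator_expMeasure hlam ((continuous_pow q).mul
        ((continuous_legFormula n (p - q)).comp (continuous_const.sub continuous_id)))
        s).mul_prod (hcos q)).const_mul _
    rw [integral_finsetSum _ fun q _ => hterm q]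
    refine Finset.sum_congr rfl fun q _ => ?_
    rw [integral_const_mul]
    congr 1
    exact integral_prod_mul _ (fun θ => Real.cos θ ^ q)

end moments

/-! ### Counting events and the conditional law at a fixed time -/

/-- Position at time `s` as a function of the waiting times and of the angles. -/
noncomputable def canonicalPosition (c s : ℝ) (z : (ℕ → ℝ) × (ℕ → ℝ)) : ℝ :=
  position c (fun j (z : (ℕ → ℝ) × (ℕ → ℝ)) => z.1 j) (fun j z => z.2 j) s z

/-- Number of events in `(0, s]` as a function of the waiting times and of the angles. -/
noncomputable def canonicalCount (s : ℝ) (z : (ℕ → ℝ) × (ℕ → ℝ)) : ℕ :=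
  eventCount (fun j (z : (ℕ → ℝ) × (ℕ → ℝ)) => z.1 j) s z

lemma canonicalCount_eq_ncard (s : ℝ) (z : (ℕ → ℝ) × (ℕ → ℝ)) :
    canonicalCount s z = Set.ncard {j : ℕ | walk z.1 (j + 1) ≤ s} := rfl

lemma canonicalPosition_eq (c s : ℝ) (z : (ℕ → ℝ) × (ℕ → ℝ)) :
    canonicalPosition c s z = c * legSum (canonicalCount s z) s z := by
  have h : ∀ j, eventTime (fun j (z : (ℕ → ℝ) × (ℕ → ℝ)) => z.1 j) (j + 1) z -
      eventTime (fun j (z : (ℕ → ℝ) × (ℕ → ℝ)) => z.1 j) j z = z.1 j := fun j => by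
    simp [eventTime, Finset.sum_range_succ]
  unfold canonicalPosition position
  simp only [h]
  rfl

lemma walk_mono {e : ℕ → ℝ} (he : ∀ i, 0 < e i) : Monotone (walk e) :=
  monotone_nat_of_le_succ fun n => by rw [walk_succ]; linarith [he n]

lemma canonicalCount_eq_of_eventsAt {z : (ℕ → ℝ) × (ℕ → ℝ)} (hz : ∀ i, 0 < z.1 i) {n : ℕ} {s : ℝ}
    (h : EventsAt n s z.1) : canonicalCount s z = n := by
  have : {j : ℕ | walk z.1 (j + 1) ≤ s} = ((Finset.range n : Finset ℕ) : Set ℕ) := by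
    ext j
    simp only [Set.mem_ofPred_eq, Finset.coe_range, Set.mem_Iio]
    constructor
    · intro hj
      by_contra! hn
      exact absurd (h.2.trans_le (walk_mono hz (show n + 1 ≤ j + 1 by omega))) (not_lt.2 hj)
    · exact fun hj => (walk_mono hz (show j + 1 ≤ n by omega)).trans h.1
  rw [canonicalCount_eq_ncard, this, Set.ncard_coe_finset, Finset.card_range]

lemma measurable_canonicalCount :
    Measurable fun p : ℝ × ((ℕ → ℝ) × (ℕ → ℝ)) => canonicalCount p.1 p.2 := by
  have hmem : ∀ j : ℕ, MeasurableSet {p : ℝ × ((ℕ → ℝ) × (ℕ → ℝ)) | walk p.2.1 (j + 1) ≤ p.1} :=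
    fun j => measurableSet_le (by unfold walk; fun_prop) measurable_fst
  have hF : ∀ F : Finset ℕ, MeasurableSet {p : ℝ × ((ℕ → ℝ) × (ℕ → ℝ)) |
      {j : ℕ | walk p.2.1 (j + 1) ≤ p.1} = (F : Set ℕ)} := by
    intro F
    have : {p : ℝ × ((ℕ → ℝ) × (ℕ → ℝ)) | {j : ℕ | walk p.2.1 (j + 1) ≤ p.1} = (F : Set ℕ)} =
        ⋂ j : ℕ, {p | walk p.2.1 (j + 1) ≤ p.1 ↔ j ∈ F} := by
      ext p
      simp [Set.ext_iff]
    rw [this]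
    refine MeasurableSet.iInter fun j => ?_
    by_cases hj : j ∈ F
    · simpa [hj] using hmem j
    · convert (hmem j).compl using 1
      ext p
      simp [hj]
  have hpos : ∀ k : ℕ, 0 < k → MeasurableSet ((fun p : ℝ × ((ℕ → ℝ) × (ℕ → ℝ)) =>
      canonicalCount p.1 p.2) ⁻¹' {k}) := by
    intro k hk
    have : (fun p : ℝ × ((ℕ → ℝ) × (ℕ → ℝ)) => canonicalCount p.1 p.2) ⁻¹' {k} =
        ⋃ F ∈ {F : Finset ℕ | F.card = k}, {p : ℝ × ((ℕ → ℝ) × (ℕ → ℝ)) |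
          {j : ℕ | walk p.2.1 (j + 1) ≤ p.1} = (F : Set ℕ)} := by
      ext p
      simp only [Set.mem_preimage, Set.mem_singleton_iff, canonicalCount_eq_ncard, Set.mem_iUnion,
        Set.mem_ofPred_eq, exists_prop]
      constructor
      · intro h
        have hfin : {j : ℕ | walk p.2.1 (j + 1) ≤ p.1}.Finite :=
          Set.finite_of_ncard_pos (by omega)
        refine ⟨hfin.toFinset, ?_, by simp⟩
        rw [← Set.ncard_eq_toFinset_card _ hfin, h]
      · rintro ⟨F, hF, h⟩
        rw [h, Set.ncard_coe_finset, hF]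
    rw [this]
    exact MeasurableSet.biUnion (Set.to_countable _) fun F _ => hF F
  refine measurable_to_countable' fun k => ?_
  rcases Nat.eq_zero_or_pos k with rfl | hk
  -- `Set.ncard` is also `0` on infinite sets, so the value `0` is handled as the complement of the
  -- positive values.
  · have : (fun p : ℝ × ((ℕ → ℝ) × (ℕ → ℝ)) => canonicalCount p.1 p.2) ⁻¹' {0} =
        (⋃ k : ℕ, (fun p : ℝ × ((ℕ → ℝ) × (ℕ → ℝ)) => canonicalCount p.1 p.2) ⁻¹' {k + 1})ᶜ := by
      ext p
      simp only [Set.mem_preimage, Set.mem_singleton_iff, Set.mem_compl_iff, Set.mem_iUnion,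
        not_exists]
      constructor
      · intro h j; omega
      · intro h
        by_contra h0
        exact h (canonicalCount p.1 p.2 - 1) (by omega)
    rw [this]
    exact (MeasurableSet.iUnion fun k => hpos _ k.succ_pos).compl
  · exact hpos k hk

lemma measurable_canonicalPosition (c : ℝ) :
    Measurable fun p : ℝ × ((ℕ → ℝ) × (ℕ → ℝ)) => canonicalPosition c p.1 p.2 := by
  simp_rw [canonicalPosition_eq]
  have : Measurable fun q : ℕ × (ℝ × ((ℕ → ℝ) × (ℕ → ℝ))) => legSum q.1 q.2.1 q.2.2 :=
    measurable_from_prod_countable_right fun n => measurable_legSum n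
  exact (this.comp (measurable_canonicalCount.prodMk measurable_id)).const_mul c

section canonical

variable {lam : ℝ} {α : Measure ℝ} [IsProbabilityMeasure α]

/-- The Poisson probabilities are the moments of order zero. -/
lemma measureReal_eventsAt (hlam : 0 < lam) (n : ℕ) {s : ℝ} (hs : 0 ≤ s) :
    (inputLaw lam α).real {z | EventsAt n s z.1} =
      Real.exp (-(lam * s)) * (lam * s) ^ n / n.factorial := by
  have h := integral_legPow (α := α) hlam n 0 hs
  simp only [legPow, pow_zero] at h
  rw [integral_indicator_const _ (measurableSet_eventsAt_right n s), smul_eq_mul, mul_one] at h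
  rw [h, legFormula, legMoment_zero_right]
  simp [mul_pow]
  ring

lemma disjoint_eventsAt {e : ℕ → ℝ} (he : ∀ i, 0 < e i) {m n : ℕ} {s : ℝ} (hm : EventsAt m s e)
    (hn : EventsAt n s e) : m = n := by
  have h1 := canonicalCount_eq_of_eventsAt (z := (e, e)) he hm
  have h2 := canonicalCount_eq_of_eventsAt (z := (e, e)) he hn
  exact h1.symm.trans h2

/-- The Poisson probabilities sum to one. This excludes infinitely many events before `s`, where the
count would have the default value `0`. -/
lemma ae_exists_eventsAt (hlam : 0 < lam) {s : ℝ} (hs : 0 ≤ s) :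
    ∀ᵐ z ∂inputLaw lam α, ∃ n, EventsAt n s z.1 := by
  have := isProbabilityMeasure_inputLaw (α := α) hlam
  have hdisj : Pairwise (Function.onFun (AEDisjoint (inputLaw lam α))
      fun n => {z : (ℕ → ℝ) × (ℕ → ℝ) | EventsAt n s z.1}) := by
    intro m n hmn
    refine measure_eq_zero_iff_ae_notMem.2 ?_
    filter_upwards [ae_pos_inputLaw hlam] with z hz hz'
    exact hmn (disjoint_eventsAt hz hz'.1 hz'.2)
  have hsum : HasSum (fun n : ℕ => Real.exp (-(lam * s)) * (lam * s) ^ n / n.factorial) 1 := by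
    have h := (NormedSpace.expSeries_div_hasSum_exp (lam * s)).mul_left (Real.exp (-(lam * s)))
    rw [← Real.exp_eq_exp_ℝ, ← Real.exp_add, neg_add_cancel, Real.exp_zero] at h
    simpa [mul_div_assoc] using h
  have hunion : inputLaw lam α (⋃ n, {z | EventsAt n s z.1}) = 1 := by
    rw [measure_iUnion₀ hdisj fun n => (measurableSet_eventsAt_right n s).nullMeasurableSet]
    have : ∀ n : ℕ, inputLaw lam α {z | EventsAt n s z.1} =
        ENNReal.ofReal (Real.exp (-(lam * s)) * (lam * s) ^ n / n.factorial) := fun n => by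
      rw [← measureReal_eventsAt (α := α) hlam n hs, ofReal_measureReal]
    simp_rw [this]
    rw [← ENNReal.ofReal_tsum_of_nonneg (fun n => by positivity) hsum.summable, hsum.tsum_eq,
      ENNReal.ofReal_one]
  have hae := (prob_compl_eq_zero_iff (MeasurableSet.iUnion
    fun n => measurableSet_eventsAt_right n s)).2 hunion
  filter_upwards [measure_eq_zero_iff_ae_notMem.1 hae] with z hz
  simpa using hz

lemma ae_canonicalCount_eq_iff (hlam : 0 < lam) {s : ℝ} (hs : 0 ≤ s) (n : ℕ) :
    ∀ᵐ z ∂inputLaw lam α, canonicalCount s z = n ↔ EventsAt n s z.1 := by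
  filter_upwards [ae_exists_eventsAt hlam hs, ae_pos_inputLaw hlam] with z hz hpos
  obtain ⟨k, hk⟩ := hz
  refine ⟨fun h => ?_, canonicalCount_eq_of_eventsAt hpos⟩
  rw [canonicalCount_eq_of_eventsAt hpos hk] at h
  rwa [← h]

lemma measureReal_canonicalCount (hlam : 0 < lam) {s : ℝ} (hs : 0 ≤ s) (n : ℕ) :
    (inputLaw lam α).real {z | canonicalCount s z = n} =
      Real.exp (-(lam * s)) * (lam * s) ^ n / n.factorial := by
  rw [← measureReal_eventsAt (α := α) hlam n hs]
  refine measureReal_congr ?_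
  filter_upwards [ae_canonicalCount_eq_iff hlam hs n] with z hz using propext hz

lemma measurableSet_canonicalCount (s : ℝ) (n : ℕ) : MeasurableSet {z | canonicalCount s z = n} :=
  (measurable_canonicalCount.comp (measurable_const.prodMk measurable_id))
    (measurableSet_singleton n)

/-- The law of the position at a fixed time given the number of changes of velocity, from its
moments. -/
theorem map_restrict_canonicalPosition (hlam : 0 < lam) {c s : ℝ} (hc : 0 < c) (hs : 0 < s) (n : ℕ)
    {ρ : Measure ℝ} [IsProbabilityMeasure ρ] (hρ : ∀ᵐ x ∂ρ, |x| ≤ 1)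
    (hmoment : ∀ p : ℕ, ∫ x, x ^ p ∂ρ =
      p.factorial * n.factorial / (n + p).factorial * legMoment α n p) :
    ((inputLaw lam α).restrict {z | canonicalCount s z = n}).map (canonicalPosition c s) =
      inputLaw lam α {z | canonicalCount s z = n} • ρ.map (fun x => c * s * x) := by
  have := isProbabilityMeasure_inputLaw (α := α) hlam
  have hX : Measurable (canonicalPosition c s) :=
    Measurable.of_uncurry_left (f := canonicalPosition c) (measurable_canonicalPosition c)
  have hN := measurableSet_canonicalCount s n
  have hiff := ae_canonicalCount_eq_iff (α := α) hlam hs.le n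
  have : IsProbabilityMeasure (ρ.map fun x => c * s * x) :=
    Measure.isProbabilityMeasure_map (by fun_prop)
  have : IsFiniteMeasure (inputLaw lam α {z | canonicalCount s z = n} •
      ρ.map (fun x => c * s * x)) := Measure.smul_finite _ (measure_ne_top _ _)
  refine measure_ext_of_moments (R := c * s) ?_ ?_ fun p => ?_
  · rw [ae_map_iff hX.aemeasurable (measurableSet_le measurable_abs measurable_const),
      ae_restrict_iff' hN]
    filter_upwards [hiff, ae_pos_inputLaw hlam] with z hz hpos hzn
    rw [canonicalPosition_eq, hzn, abs_mul, abs_of_pos hc]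
    exact mul_le_mul_of_nonneg_left (abs_legSum_le hpos (hz.1 hzn)) hc.le
  · refine Measure.ae_smul_measure ?_ _
    rw [ae_map_iff (by fun_prop) (measurableSet_le measurable_abs measurable_const)]
    filter_upwards [hρ] with x hx
    rw [abs_mul, abs_of_pos (by positivity)]
    exact mul_le_of_le_one_right (by positivity) hx
  · have hleft : ∫ x, x ^ p ∂((inputLaw lam α).restrict {z | canonicalCount s z = n}).map
        (canonicalPosition c s) = c ^ p * legFormula lam α n p s := by
      rw [integral_map hX.aemeasurable (by fun_prop), ← integral_legPow hlam n p hs.le,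
        ← integral_const_mul, ← integral_indicator hN]
      refine integral_congr_ae ?_
      filter_upwards [hiff] with z hz
      unfold legPow
      by_cases h : canonicalCount s z = n
      · rw [Set.indicator_of_mem (by exact h), Set.indicator_of_mem (by exact hz.1 h),
          canonicalPosition_eq, h, mul_pow]
      · rw [Set.indicator_of_notMem (by exact h),
          Set.indicator_of_notMem (by exact fun h' => h (hz.2 h')), mul_zero]
    rw [hleft, integral_smul_measure, integral_map (by fun_prop) (by fun_prop),
      ← measureReal_def, measureReal_canonicalCount hlam hs.le]
    simp_rw [mul_pow (c * s)]
    rw [integral_const_mul, hmoment p, legFormula, smul_eq_mul]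
    have : ((n.factorial : ℕ) : ℝ) ≠ 0 := by positivity
    field_simp
    ring

end canonical

/-! ### Independent random clocks -/

section input

variable {Ω : Type*} [MeasurableSpace Ω] {P : Measure Ω} {lam ν : ℝ} {E θ : ℕ → Ω → ℝ}

lemma IsMotionInput.isProbabilityMeasure_angleLaw [IsProbabilityMeasure P]
    (h : IsMotionInput lam ν E θ P) :
    IsProbabilityMeasure (angleLaw ν) :=
  (h.law_angle 0).isProbabilityMeasure_iff.1 inferInstance

lemma IsMotionInput.measurable_input (h : IsMotionInput lam ν E θ P) :
    Measurable fun ω => (fun j => E j ω, fun j => θ j ω) :=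
  (measurable_pi_lambda _ h.measurable_wait).prodMk (measurable_pi_lambda _ h.measurable_angle)

lemma IsMotionInput.map_input [IsProbabilityMeasure P] (h : IsMotionInput lam ν E θ P) :
    P.map (fun ω => (fun j => E j ω, fun j => θ j ω)) = inputLaw lam (angleLaw ν) := by
  have hE : Measurable fun ω j => E j ω := measurable_pi_lambda _ h.measurable_wait
  have hθ : Measurable fun ω j => θ j ω := measurable_pi_lambda _ h.measurable_angle
  rw [(indepFun_iff_map_prod_eq_prod_map_map hE.aemeasurable hθ.aemeasurable).1 h.indep_wait_angle,
    (h.indep_wait.hasLaw_infinitePi h.law_wait hE.aemeasurable).map_eq,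
    (h.indep_angle.hasLaw_infinitePi h.law_angle hθ.aemeasurable).map_eq, inputLaw]

end input

/-- The law of `c * s * ξ` for `ξ` of law `ρ`, as a kernel in `s`. -/
noncomputable def scaleKernel (c : ℝ) (ρ : Measure ℝ) : Kernel ℝ ℝ :=
  (Kernel.id ×ₖ Kernel.const ℝ ρ).map fun p => c * p.1 * p.2

lemma scaleKernel_apply (c : ℝ) (ρ : Measure ℝ) [SFinite ρ] (s : ℝ) :
    scaleKernel c ρ s = ρ.map fun x => c * s * x := by
  rw [scaleKernel, Kernel.map_apply _ (by fun_prop), Kernel.prod_apply, Kernel.id_apply,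
    Kernel.const_apply, Measure.dirac_prod, Measure.map_map (by fun_prop) (by fun_prop)]
  rfl

instance (c : ℝ) (ρ : Measure ℝ) [IsProbabilityMeasure ρ] : IsMarkovKernel (scaleKernel c ρ) :=
  Kernel.IsMarkovKernel.map _ (by fun_prop)

/-- Conditioning a measurable process `X` at an independent random time `τ` on `τ = s` and on the
value `n` of a counting process. -/
lemma ae_condDistrib_eq {Ω 𝓩 : Type*} [MeasurableSpace Ω] [MeasurableSpace 𝓩] {P : Measure Ω}
    [IsProbabilityMeasure P] {Z : Ω → 𝓩} (hZ : Measurable Z) {N : ℝ → 𝓩 → ℕ} {X : ℝ → 𝓩 → ℝ}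
    (hN : Measurable fun p : ℝ × 𝓩 => N p.1 p.2) (hX : Measurable fun p : ℝ × 𝓩 => X p.1 p.2)
    {τ : Ω → ℝ} (hτ : Measurable τ) (hind : IndepFun Z τ P) (n : ℕ)
    (hne : ∀ᵐ s ∂P.map τ, P.map Z {z | N s z = n} ≠ 0) {κ : Kernel ℝ ℝ} [IsMarkovKernel κ]
    (hκ : ∀ᵐ s ∂P.map τ, ((P.map Z).restrict {z | N s z = n}).map (X s) =
      P.map Z {z | N s z = n} • κ s) :
    ∀ᵐ s ∂P.map τ, condDistrib (fun ω => X (τ ω) (Z ω)) (fun ω => (τ ω, N (τ ω) (Z ω))) P (s, n) =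
      κ s := by
  have hτZ : P.map (fun ω => (τ ω, Z ω)) = (P.map τ).prod (P.map Z) :=
    (indepFun_iff_map_prod_eq_prod_map_map hτ.aemeasurable hZ.aemeasurable).1 hind.symm
  have : IsProbabilityMeasure (P.map τ) := Measure.isProbabilityMeasure_map hτ.aemeasurable
  have : IsProbabilityMeasure (P.map Z) := Measure.isProbabilityMeasure_map hZ.aemeasurable
  set Q := P.map Z
  set T := P.map τ
  set g : ℝ × 𝓩 → ℝ × ℕ := fun p => (p.1, N p.1 p.2) with hg_def
  set Y := fun ω => X (τ ω) (Z ω)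
  set V := fun ω => (τ ω, N (τ ω) (Z ω))
  have hg : Measurable g := measurable_fst.prodMk hN
  have hτZm : Measurable fun ω => (τ ω, Z ω) := hτ.prodMk hZ
  have hY : Measurable Y := hX.comp hτZm
  have hV : Measurable V := hg.comp hτZm
  have hμ : P.map V = (T.prod Q).map g := by rw [← hτZ, Measure.map_map hg hτZm]; rfl
  have hVY : P.map (fun ω => (V ω, Y ω)) =
      (T.prod Q).map fun p => (g p, X p.1 p.2) := by
    rw [← hτZ, Measure.map_map (hg.prodMk hX) hτZm]; rfl
  have : IsProbabilityMeasure (P.map V) := Measure.isProbabilityMeasure_map hV.aemeasurable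
  have hS : MeasurableSet {v : ℝ × ℕ | v.2 = n} := measurable_snd (measurableSet_singleton n)
  -- Only the slice with count `n` is constrained by `hκ`; equality of the composition products
  -- there determines the conditional kernel almost everywhere on the slice.
  have key : (P.map V).restrict {v | v.2 = n} ⊗ₘ condDistrib Y V P =
      (P.map V).restrict {v | v.2 = n} ⊗ₘ (κ.comap Prod.fst measurable_fst) := by
    refine Measure.ext_prod fun {A B} hA hB => ?_
    have hAS : MeasurableSet (A ∩ {v : ℝ × ℕ | v.2 = n}) := hA.inter hS
    rw [Measure.compProd_apply_prod hA hB, Measure.compProd_apply_prod hA hB,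
      Measure.restrict_restrict hA, ← Measure.compProd_apply_prod hAS hB,
      compProd_map_condDistrib hY.aemeasurable, hVY,
      Measure.map_apply (hg.prodMk hX) (hAS.prod hB),
      Measure.prod_apply ((hg.prodMk hX) (hAS.prod hB)), ← lintegral_indicator hAS, hμ,
      lintegral_map ((Kernel.measurable_coe _ hB).indicator hAS) hg,
      lintegral_prod _ (by
        exact (((Kernel.measurable_coe _ hB).indicator hAS).comp hg).aemeasurable)]
    refine lintegral_congr_ae ?_
    filter_upwards [hκ] with s hs
    have hXs : Measurable (X s) :=
      Measurable.of_uncurry_left (f := X) hX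
    have hNs : MeasurableSet {z | N s z = n} :=
      (hN.comp (measurable_const.prodMk measurable_id)) (measurableSet_singleton n)
    by_cases hsA : (s, n) ∈ A
    · have h1 : Prod.mk s ⁻¹' ((fun p => (g p, X p.1 p.2)) ⁻¹'
          ((A ∩ {v | v.2 = n}) ×ˢ B)) =
          X s ⁻¹' B ∩ {z | N s z = n} := by
        ext z
        simp only [hg_def, Set.mem_preimage, Set.mem_prod, Set.mem_inter_iff, Set.mem_ofPred_eq]
        constructor
        · exact fun h => ⟨h.2, h.1.2⟩
        · exact fun h => ⟨⟨by rw [h.2]; exact hsA, h.2⟩, h.1⟩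
      rw [h1, ← Measure.restrict_apply (hXs hB), ← Measure.map_apply hXs hB, hs]
      have h2 : ∀ z, (A ∩ {v | v.2 = n}).indicator
          (fun v : ℝ × ℕ => κ v.1 B) (g (s, z)) =
          {z | N s z = n}.indicator (fun _ => κ s B) z := by
        intro z
        by_cases hz : N s z = n
        · rw [Set.indicator_of_mem (a := z) (by exact hz), Set.indicator_of_mem]
          refine ⟨?_, hz⟩
          simp only [hg_def]
          rwa [hz]
        · rw [Set.indicator_of_notMem (a := z) (by exact hz),
            Set.indicator_of_notMem (fun h => hz h.2)]
      simp_rw [Kernel.comap_apply, h2]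
      rw [lintegral_indicator_const hNs, Measure.smul_apply, smul_eq_mul, mul_comm]
    · have hnot : ∀ z, g (s, z) ∉ A ∩ {v | v.2 = n} := by
        rintro z ⟨h1, h2⟩
        have h2' : N s z = n := h2
        simp only [hg_def] at h1
        rw [h2'] at h1
        exact hsA h1
      have h1 : Prod.mk s ⁻¹' ((fun p => (g p, X p.1 p.2)) ⁻¹'
          ((A ∩ {v | v.2 = n}) ×ˢ B)) = ∅ := by
        ext z
        exact iff_of_false (fun h => hnot z h.1) (Set.notMem_empty z)
      rw [h1, measure_empty]
      simp_rw [Set.indicator_of_notMem (hnot _), lintegral_zero]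
  have hae := Kernel.ae_eq_of_compProd_eq key
  rw [Filter.EventuallyEq, ae_restrict_iff' hS, hμ] at hae
  have hae2 := Measure.ae_ae_of_ae_prod (ae_of_ae_map hg.aemeasurable hae)
  filter_upwards [hae2, hne] with s hs hpos'
  -- The kernels agree for almost every input with count `n`; as these have positive probability at
  -- time `s`, one of them can be chosen to evaluate at `(s, n)`.
  obtain ⟨z, hz, hz'⟩ := ((frequently_ae_iff.2 hpos').and_eventually hs).exists
  have h := hz' hz
  simp only [hg_def] at h
  rw [hz] at h
  exact h

/-- The law of the motion at an independent positive random time given the number of changes of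
velocity. -/
theorem IsMotionInput.lawAtClock_eq {lam : ℝ} {Ω : Type*} [MeasurableSpace Ω] {P : Measure Ω}
    [IsProbabilityMeasure P] {ν : ℝ} {E θ : ℕ → Ω → ℝ} (h : IsMotionInput lam ν E θ P)
    (hlam : 0 < lam) {c : ℝ} (hc : 0 < c) {τ τ' : Ω → ℝ} (hτ : Measurable τ) (hττ' : τ' =ᵐ[P] τ)
    (hpos : ∀ᵐ ω ∂P, 0 < τ ω)
    (hind : IndepFun (fun ω => (fun j => E j ω, fun j => θ j ω)) τ P) (n : ℕ)
    {ρ : Measure ℝ} [IsProbabilityMeasure ρ] (hρ : ∀ᵐ x ∂ρ, |x| ≤ 1)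
    (hmoment : ∀ p : ℕ, ∫ x, x ^ p ∂ρ =
      p.factorial * n.factorial / (n + p).factorial * legMoment (angleLaw ν) n p) :
    lawAtClock P (eventCount E) (position c E θ) τ' n =
      (P.map τ).bind fun s => ρ.map fun x => c * s * x := by
  have := h.isProbabilityMeasure_angleLaw
  have hX : (fun ω => position c E θ (τ' ω) ω) =ᵐ[P] fun ω =>
      canonicalPosition c (τ ω) (fun j => E j ω, fun j => θ j ω) := by
    filter_upwards [hττ'] with ω hω
    rw [hω]
    rfl
  have hV : (fun ω => (τ' ω, eventCount E (τ' ω) ω)) =ᵐ[P] fun ω =>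
      (τ ω, canonicalCount (τ ω) (fun j => E j ω, fun j => θ j ω)) := by
    filter_upwards [hττ'] with ω hω
    rw [hω]
    rfl
  rw [lawAtClock, condDistrib_congr hX hV, Measure.map_congr hττ']
  refine Measure.bind_congr_right ?_
  have hT : ∀ᵐ s ∂P.map τ, 0 < s :=
    (ae_map_iff hτ.aemeasurable (measurableSet_lt measurable_const measurable_id)).2 hpos
  have hae := ae_condDistrib_eq (κ := scaleKernel c ρ) h.measurable_input
    measurable_canonicalCount (measurable_canonicalPosition c) hτ hind n (by
      rw [h.map_input]
      filter_upwards [hT] with s hs h0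
      have hr := measureReal_canonicalCount (α := angleLaw ν) hlam hs.le n
      rw [measureReal_def, h0, ENNReal.toReal_zero] at hr
      have : 0 < Real.exp (-(lam * s)) * (lam * s) ^ n / n.factorial := by positivity
      linarith) (by
      rw [h.map_input]
      filter_upwards [hT] with s hs
      rw [scaleKernel_apply]
      exact map_restrict_canonicalPosition hlam hc hs n hρ hmoment)
  filter_upwards [hae] with s hs
  rw [hs, scaleKernel_apply]

/-! ### Identification with the Beta mixture -/

section legMoment

lemma sum_range_two_mul_add_one {M : Type*} [AddCommMonoid M] (f : ℕ → M) (k : ℕ) :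
    ∑ q ∈ Finset.range (2 * k + 1), f q =
      ∑ i ∈ Finset.range (k + 1), f (2 * i) + ∑ i ∈ Finset.range k, f (2 * i + 1) := by
  induction k with
  | zero => simp
  | succ k ih =>
    rw [show 2 * (k + 1) + 1 = 2 * k + 1 + 1 + 1 by ring, Finset.sum_range_succ,
      Finset.sum_range_succ, ih, Finset.sum_range_succ (fun i => f (2 * i)) (k + 1),
      Finset.sum_range_succ (fun i => f (2 * i + 1)) k, show 2 * (k + 1) = 2 * k + 1 + 1 by ring]
    abel

lemma legMoment_odd (m : Fin 2) (n k : ℕ) : legMoment (angleLaw ((m : ℕ) : ℝ)) n (2 * k + 1) = 0 := by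
  induction n generalizing k with
  | zero => exact integral_cos_pow_odd_angleLaw m k
  | succ n ih =>
    rw [legMoment]
    refine Finset.sum_eq_zero fun q hq => ?_
    rcases Nat.even_or_odd' q with ⟨i, rfl | rfl⟩
    · rw [show 2 * k + 1 - 2 * i = 2 * (k - i) + 1 by rw [Finset.mem_range] at hq; omega, ih,
        mul_zero]
    · rw [integral_cos_pow_odd_angleLaw, zero_mul]

/-- Odd cosine moments vanish, so the convolution runs over even indices only and is a product of
power series. -/
lemma legMoment_even (m : Fin 2) (n k : ℕ) : legMoment (angleLaw ((m : ℕ) : ℝ)) n (2 * k) =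
    PowerSeries.coeff k (cosSeries m ^ (n + 1)) := by
  induction n generalizing k with
  | zero =>
    rw [zero_add, pow_one, cosSeries, PowerSeries.coeff_mk]
    exact integral_cos_pow_even_angleLaw m k
  | succ n ih =>
    rw [legMoment, sum_range_two_mul_add_one, pow_succ', PowerSeries.coeff_mul,
      Finset.Nat.sum_antidiagonal_eq_sum_range_succ_mk]
    simp_rw [integral_cos_pow_odd_angleLaw, zero_mul, Finset.sum_const_zero, add_zero,
      integral_cos_pow_even_angleLaw, ← Nat.mul_sub, ih]
    simp [cosSeries]

end legMoment

section beta

lemma betaPDFReal_nonneg {a b : ℝ} (ha : 0 < a) (hb : 0 < b) (x : ℝ) : 0 ≤ betaPDFReal a b x := by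
  by_cases hx : 0 < x ∧ x < 1
  · exact (betaPDFReal_pos hx.1 hx.2 ha hb).le
  · rw [betaPDFReal, if_neg hx]

lemma integral_betaPDFReal {a b : ℝ} (ha : 0 < a) (hb : 0 < b) : ∫ x, betaPDFReal a b x = 1 := by
  rw [integral_eq_lintegral_of_nonneg_ae (Filter.Eventually.of_forall (betaPDFReal_nonneg ha hb))
    (by fun_prop)]
  exact (congrArg _ (lintegral_betaPDF_eq_one ha hb)).trans ENNReal.toReal_one

lemma ae_mem_Ioo_betaMeasure (a b : ℝ) : ∀ᵐ w ∂betaMeasure a b, w ∈ Set.Ioo 0 1 := by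
  rw [betaMeasure, ae_withDensity_iff (by unfold betaPDF; fun_prop)]
  refine Filter.Eventually.of_forall fun w hw => ?_
  by_contra h
  exact hw (by rw [betaPDF, betaPDFReal, if_neg (by exact h), ENNReal.ofReal_zero])

lemma beta_add_one_div {v : ℝ} (hv : 0 < v) (k : ℕ) :
    beta (1 + (k + 1 : ℕ)) v = beta (1 + k) v * ((k + 1) / (1 + v + k)) := by
  have h1 : (0 : ℝ) < 1 + k := by positivity
  have h2 : 0 < 1 + k + v := by positivity
  have h3 := (Real.Gamma_pos_of_pos h2).ne'
  rw [beta, beta, show (1 + ((k + 1 : ℕ) : ℝ)) = (1 + k) + 1 by push_cast; ring,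
    Real.Gamma_add_one h1.ne', show (1 + (k : ℝ)) + 1 + v = 1 + k + v + 1 by ring,
    Real.Gamma_add_one h2.ne']
  have h4 : 1 + v + k ≠ 0 := by positivity
  field_simp
  ring

/-- Multiplying the Beta density of parameters `1, v` by `w ^ k` gives a multiple of the density of
parameters `1 + k, v`; the ratio of normalizations telescopes. -/
lemma integral_pow_betaMeasure {v : ℝ} (hv : 0 < v) (k : ℕ) :
    ∫ w, w ^ k ∂betaMeasure 1 v = betaMoment v k := by
  have hfin : ∀ᵐ x : ℝ, betaPDF 1 v x < ∞ :=
    Filter.Eventually.of_forall fun x => ENNReal.ofReal_lt_top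
  have hb1 := beta_pos one_pos hv
  have hbk := beta_pos (show (0 : ℝ) < 1 + k by positivity) hv
  have hratio : beta (1 + k) v / beta 1 v = betaMoment v k := by
    clear hbk
    induction k with
    | zero => simp [betaMoment, hb1.ne']
    | succ k ih => rw [beta_add_one_div hv, betaMoment_succ, ← ih]; ring
  rw [betaMeasure, integral_withDensity_eq_integral_toReal_smul (by unfold betaPDF; fun_prop) hfin]
  have : ∀ x : ℝ, (betaPDF 1 v x).toReal • x ^ k =
      beta (1 + k) v / beta 1 v * betaPDFReal (1 + k) v x := by
    intro x
    rw [betaPDF, ENNReal.toReal_ofReal (betaPDFReal_nonneg one_pos hv x), smul_eq_mul, betaPDFReal,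
      betaPDFReal]
    by_cases hx : 0 < x ∧ x < 1
    · rw [if_pos hx, if_pos hx, sub_self, Real.rpow_zero, add_sub_cancel_left, Real.rpow_natCast]
      field_simp
    · rw [if_neg hx, if_neg hx]; ring
  simp_rw [this]
  rw [integral_const_mul, integral_betaPDFReal (by positivity) hv, mul_one, hratio]

end beta

section conditionalLaw

/-- The law of `√W * cos Θ`, where `W` has the Beta distribution with parameters `1` and `v` and `Θ`
is uniform and independent of `W`. -/
noncomputable def betaCosLaw (v : ℝ) : Measure ℝ :=
  ((betaMeasure 1 v).prod (angleLaw 0)).map fun p => √p.1 * Real.cos p.2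

variable {v : ℝ}

lemma isProbabilityMeasure_betaCosLaw (hv : 0 < v) : IsProbabilityMeasure (betaCosLaw v) := by
  have := isProbabilityMeasureBeta one_pos hv
  exact Measure.isProbabilityMeasure_map (by fun_prop)

lemma ae_abs_le_betaCosLaw (hv : 0 < v) : ∀ᵐ x ∂betaCosLaw v, |x| ≤ 1 := by
  have := isProbabilityMeasureBeta one_pos hv
  rw [betaCosLaw, ae_map_iff (by fun_prop) (measurableSet_le measurable_abs measurable_const)]
  filter_upwards [Measure.quasiMeasurePreserving_fst.ae (ae_mem_Ioo_betaMeasure 1 v)] with p hp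
  rw [abs_mul, abs_of_nonneg (Real.sqrt_nonneg _)]
  exact mul_le_one₀ (Real.sqrt_le_one.2 hp.2.le) (abs_nonneg _) (Real.abs_cos_le_one _)

lemma integral_pow_betaCosLaw (hv : 0 < v) (p : ℕ) : ∫ x, x ^ p ∂betaCosLaw v =
    (∫ w, √w ^ p ∂betaMeasure 1 v) * ∫ θ, Real.cos θ ^ p ∂angleLaw 0 := by
  have := isProbabilityMeasureBeta one_pos hv
  rw [betaCosLaw, integral_map (by fun_prop) (by fun_prop)]
  simp_rw [mul_pow]
  exact integral_prod_mul (fun w => √w ^ p) fun θ => Real.cos θ ^ p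

/-- Matches the hypothesis `hmoment` of the conditional law: `betaMoment_mul_arcsineMoment` in even
degree, zero on both sides in odd degree. -/
lemma integral_pow_betaCosLaw_shape (m : Fin 2) {n : ℕ} (hn : 1 ≤ n) (p : ℕ) :
    ∫ x, x ^ p ∂betaCosLaw (shape m n) =
      p.factorial * n.factorial / (n + p).factorial * legMoment (angleLaw ((m : ℕ) : ℝ)) n p := by
  have hv := shape_pos m hn
  rw [integral_pow_betaCosLaw hv]
  have h0 : angleLaw 0 = angleLaw (((0 : Fin 2) : ℕ) : ℝ) := by simp
  rcases Nat.even_or_odd' p with ⟨k, rfl | rfl⟩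
  · rw [legMoment_even, ← betaMoment_mul_arcsineMoment m n k, h0, integral_cos_pow_even_angleLaw,
      cosMoment, if_pos rfl, ← integral_pow_betaMeasure hv k]
    congr 1
    refine integral_congr_ae ?_
    filter_upwards [ae_mem_Ioo_betaMeasure 1 (shape m n)] with w hw
    rw [pow_mul, Real.sq_sqrt hw.1.le]
  · rw [legMoment_odd, h0, integral_cos_pow_odd_angleLaw, mul_zero, mul_zero]

end conditionalLaw

lemma bind_map_mul (c : ℝ) (μ ρ : Measure ℝ) [SFinite ρ] :
    (μ.bind fun s => ρ.map fun x => c * s * x) = (μ.prod ρ).map fun p => c * p.1 * p.2 := by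
  have h : (fun s => ρ.map fun x => c * s * x) = scaleKernel c ρ :=
    funext fun s => (scaleKernel_apply c ρ s).symm
  ext A hA
  rw [h, Measure.bind_apply hA (scaleKernel c ρ).measurable.aemeasurable,
    Measure.map_apply (by fun_prop) hA,
    Measure.prod_apply (hA.preimage (by fun_prop))]
  refine lintegral_congr fun s => ?_
  rw [scaleKernel_apply, Measure.map_apply (by fun_prop) hA]
  rfl

/-- Regroups `s * (√w * cos θ)` as `(s * √w) * cos θ`, moving the Beta factor from the position to
the clock. -/
lemma map_prod_betaCosLaw (c : ℝ) {v : ℝ} (hv : 0 < v) (μ : Measure ℝ) [SFinite μ] :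
    (μ.prod (betaCosLaw v)).map (fun p => c * p.1 * p.2) =
      (((μ.prod (betaMeasure 1 v)).map fun q => q.1 * √q.2).prod
        ((angleLaw 0).map Real.cos)).map fun p => c * p.1 * p.2 := by
  have := isProbabilityMeasureBeta one_pos hv
  have h1 : μ.prod (betaCosLaw v) = (μ.prod ((betaMeasure 1 v).prod (angleLaw 0))).map
      (Prod.map id fun p => √p.1 * Real.cos p.2) := by
    rw [betaCosLaw, ← Measure.map_prod_map _ _ measurable_id (by fun_prop), Measure.map_id]
  rw [h1, Measure.map_prod_map _ _ (by fun_prop) (by fun_prop), ← Measure.prodAssoc_prod,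
    Measure.map_map (by fun_prop) (by fun_prop), Measure.map_map (by fun_prop) (by fun_prop),
    Measure.map_map (by fun_prop) (by fun_prop)]
  congr 1
  ext p
  simp [MeasurableEquiv.prodAssoc]
  ring

/-! ### The explicit density -/

/-- Density at `x` of the position at time `s`, up to normalization, when a fraction `√w` of the
time `s` is run in a direction of uniform angle. -/
noncomputable def switchDensity (c v s w x : ℝ) : ℝ≥0∞ :=
  Set.indicator {w : ℝ | |x| < c * s * Real.sqrt w}
    (fun w => ENNReal.ofReal ((1 - w) ^ (v - 1) *
      (1 / Real.pi) * (1 / Real.sqrt (c ^ 2 * s ^ 2 * w - x ^ 2)))) w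

lemma measurable_switchDensity (c v : ℝ) :
    Measurable fun p : ℝ × ℝ × ℝ => switchDensity c v p.1 p.2.1 p.2.2 := by
  have h : (fun p : ℝ × ℝ × ℝ => switchDensity c v p.1 p.2.1 p.2.2) =
      {p : ℝ × ℝ × ℝ | |p.2.2| < c * p.1 * √p.2.1}.indicator
        fun p => ENNReal.ofReal ((1 - p.2.1) ^ (v - 1) * (1 / Real.pi) *
          (1 / Real.sqrt (c ^ 2 * p.1 ^ 2 * p.2.1 - p.2.2 ^ 2))) := by
    ext p
    rfl
  rw [h]
  exact Measurable.indicator (by fun_prop) (measurableSet_lt (by fun_prop) (by fun_prop))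

lemma map_cos_angleLaw_zero_apply {c s w : ℝ} (hc : 0 < c) (hs : 0 < s) (hw : w ∈ Set.Ioo 0 1)
    (v : ℝ) {A : Set ℝ} (hA : MeasurableSet A) :
    ENNReal.ofReal ((1 - w) ^ (v - 1)) *
      (angleLaw 0).map (fun θ => c * s * (√w * Real.cos θ)) A =
        ∫⁻ x in A, switchDensity c v s w x := by
  have hr : 0 < c * s * √w := by have := Real.sqrt_pos.2 hw.1; positivity
  have h := map_cos_angleLaw_zero 0 hr
  simp only [zero_add, zero_sub, sub_zero, mul_assoc] at h ⊢
  simp only [← mul_assoc] at h ⊢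
  rw [h, withDensity_apply _ hA, Measure.restrict_restrict hA, Set.inter_comm,
    ← Measure.restrict_restrict measurableSet_Ioo, ← lintegral_const_mul _ (by fun_prop),
    ← lintegral_indicator measurableSet_Ioo]
  refine lintegral_congr fun x => ?_
  unfold switchDensity
  by_cases hx : |x| < c * s * √w
  · rw [Set.indicator_of_mem (a := w) (by exact hx), Set.indicator_of_mem (by exact abs_lt.1 hx),
      ← ENNReal.ofReal_mul (Real.rpow_nonneg (by linarith [hw.2]) _), mul_assoc ((1 - w) ^ (v - 1)),
      one_div_mul_one_div, mul_pow, mul_pow, Real.sq_sqrt hw.1.le]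
  · rw [Set.indicator_of_notMem (a := w) (by exact hx),
      Set.indicator_of_notMem (by exact fun h => hx (abs_lt.2 h))]

lemma betaMeasure_one (v : ℝ) : betaMeasure 1 v = (volume.restrict (Set.Ioo 0 1)).withDensity
    fun w => ENNReal.ofReal (1 / beta 1 v * (1 - w) ^ (v - 1)) := by
  rw [betaMeasure, ← withDensity_indicator measurableSet_Ioo]
  congr 1
  ext w
  rw [betaPDF, betaPDFReal]
  by_cases hw : w ∈ Set.Ioo (0 : ℝ) 1
  · rw [if_pos (by exact hw), Set.indicator_of_mem hw, sub_self, Real.rpow_zero, mul_one]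
  · rw [if_neg (by exact hw), Set.indicator_of_notMem hw, ENNReal.ofReal_zero]

lemma map_betaCosLaw_apply {c s v : ℝ} (hc : 0 < c) (hs : 0 < s) (hv : 0 < v) {A : Set ℝ}
    (hA : MeasurableSet A) : (betaCosLaw v).map (fun x => c * s * x) A =
      ENNReal.ofReal (1 / beta 1 v) *
        ∫⁻ w in Set.Ioo (0 : ℝ) 1, ∫⁻ x in A, switchDensity c v s w x := by
  have := isProbabilityMeasureBeta one_pos hv
  have hF : Measurable fun p : ℝ × ℝ => switchDensity c v s p.1 p.2 :=
    (measurable_switchDensity c v).comp (measurable_const.prodMk measurable_id)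
  have hmeas : Measurable fun w : ℝ => (angleLaw 0).map (fun θ => c * s * (√w * Real.cos θ)) A := by
    have : ∀ w : ℝ, (angleLaw 0).map (fun θ => c * s * (√w * Real.cos θ)) A =
        angleLaw 0 (Prod.mk w ⁻¹' ((fun p : ℝ × ℝ => c * s * (√p.1 * Real.cos p.2)) ⁻¹' A)) :=
      fun w => Measure.map_apply (by fun_prop) hA
    simp_rw [this]
    exact measurable_measure_prodMk_left (hA.preimage (by fun_prop))
  rw [betaCosLaw, Measure.map_map (by fun_prop) (by fun_prop), Measure.map_apply (by fun_prop) hA,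
    Measure.prod_apply (hA.preimage (by fun_prop)), ← lintegral_const_mul _ hF.lintegral_prod_right,
    betaMeasure_one]
  have : ∀ w : ℝ, angleLaw 0 (Prod.mk w ⁻¹' (((fun x => c * s * x) ∘
      fun p : ℝ × ℝ => √p.1 * Real.cos p.2) ⁻¹' A)) =
      (angleLaw 0).map (fun θ => c * s * (√w * Real.cos θ)) A :=
    fun w => (Measure.map_apply (by fun_prop) hA).symm
  simp_rw [this]
  rw [lintegral_withDensity_eq_lintegral_mul _ (by fun_prop) hmeas]
  refine setLIntegral_congr_fun measurableSet_Ioo fun w hw => ?_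
  simp only [Pi.mul_apply]
  rw [ENNReal.ofReal_mul (one_div_pos.2 (beta_pos one_pos hv)).le, mul_assoc,
    map_cos_angleLaw_zero_apply hc hs hw v hA]

/-- Tonelli: the mixture over `s`, `w` and the angle, evaluated on a set `A`, is rearranged so that
the integral over `A` comes outermost. -/
theorem bind_arcsineLaw_betaCosLaw {c t v : ℝ} (hc : 0 < c) (hv : 0 < v) :
    ((arcsineLaw t).bind fun s => (betaCosLaw v).map fun x => c * s * x) =
      volume.withDensity fun x => ENNReal.ofReal (1 / (beta 1 v * Real.pi)) *
        ∫⁻ s in Set.Ioo 0 t, ENNReal.ofReal (1 / Real.sqrt (s * (t - s))) *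
          ∫⁻ w in Set.Ioo (0 : ℝ) 1, switchDensity c v s w x := by
  have := isProbabilityMeasure_betaCosLaw hv
  have hF := measurable_switchDensity c v
  have hFw : ∀ s x, Measurable fun w => switchDensity c v s w x := fun s x =>
    hF.comp (measurable_const.prodMk (measurable_id.prodMk measurable_const))
  have hFwx : ∀ s, Measurable fun p : ℝ × ℝ => switchDensity c v s p.1 p.2 := fun s =>
    hF.comp (measurable_const.prodMk measurable_id)
  have hFsx : Measurable fun p : ℝ × ℝ =>
      ∫⁻ w in Set.Ioo (0 : ℝ) 1, switchDensity c v p.1 w p.2 := by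
    refine Measurable.lintegral_prod_right' (f := fun q : (ℝ × ℝ) × ℝ =>
      switchDensity c v q.1.1 q.2 q.1.2) ?_
    exact hF.comp ((measurable_fst.comp measurable_fst).prodMk
      (measurable_snd.prodMk (measurable_snd.comp measurable_fst)))
  have hG : Measurable fun p : ℝ × ℝ => ENNReal.ofReal (1 / Real.sqrt (p.1 * (t - p.1))) *
      ∫⁻ w in Set.Ioo (0 : ℝ) 1, switchDensity c v p.1 w p.2 := by fun_prop
  have h : (fun s => (betaCosLaw v).map fun x => c * s * x) = scaleKernel c (betaCosLaw v) :=
    funext fun s => (scaleKernel_apply c (betaCosLaw v) s).symm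
  ext A hA
  rw [h, Measure.bind_apply hA (scaleKernel c _).measurable.aemeasurable, withDensity_apply _ hA,
    lintegral_const_mul _ (by
      exact Measurable.lintegral_prod_left' hG),
    lintegral_lintegral_swap (by exact (hG.comp measurable_swap).aemeasurable),
    arcsineLaw, lintegral_withDensity_eq_lintegral_mul _ (by fun_prop)
      ((scaleKernel c _).measurable_coe hA), ← lintegral_const_mul _ (by
      exact Measurable.lintegral_prod_right' hG)]
  refine setLIntegral_congr_fun measurableSet_Ioo fun s hs => ?_
  simp only [Pi.mul_apply]
  rw [scaleKernel_apply, map_betaCosLaw_apply hc hs.1 hv hA, lintegral_const_mul _ (by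
      exact hFsx.comp (measurable_const.prodMk measurable_id)),
    lintegral_lintegral_swap (by exact (hFwx s).aemeasurable), ← one_div_mul_one_div,
    ← one_div_mul_one_div, ENNReal.ofReal_mul (by positivity),
    ENNReal.ofReal_mul (one_div_pos.2 (beta_pos one_pos hv)).le]
  ring

end FrictionMotion

/-! ### The motion at the Brownian sojourn time -/

theorem mainTheorem9
    {Ω : Type*} [MeasurableSpace Ω] (P : Measure Ω) [IsProbabilityMeasure P]
    {Ω' : Type*} [MeasurableSpace Ω'] (P' : Measure Ω') [IsProbabilityMeasure P']
    (c lam t : ℝ) (hc : 0 < c) (hlam : 0 < lam) (ht : 0 < t)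
    (m : Fin 2) (n : ℕ) (hn : 1 ≤ n)
    -- the motion `X_m` and an independent Brownian motion `B`
    (E θ : ℕ → Ω → ℝ) (hX : FrictionMotion.IsMotionInput lam ((m : ℕ) : ℝ) E θ P)
    (B : ℝ≥0 → Ω → ℝ) (hBmeas : ∀ s, Measurable (B s)) (hB : IsBrownianReal B P)
    (hXB : IndepFun (fun ω => (fun j => E j ω, fun j => θ j ω)) (fun ω s => B s ω) P)
    -- the motion `X_0`, a Brownian motion `B'` and a beta variable `W`, all independent
    (E' θ' : ℕ → Ω' → ℝ) (hX' : FrictionMotion.IsMotionInput lam 0 E' θ' P')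
    (B' : ℝ≥0 → Ω' → ℝ) (hBmeas' : ∀ s, Measurable (B' s)) (hB' : IsBrownianReal B' P')
    (W : Ω' → ℝ) (hWmeas : Measurable W)
    (hW : HasLaw W (betaMeasure 1 (FrictionMotion.shape m n)) P')
    (hBW' : IndepFun (fun ω s => B' s ω) W P')
    (hXBW' : IndepFun (fun ω => (fun j => E' j ω, fun j => θ' j ω))
      (fun ω => (fun s => B' s ω, W ω)) P') :
    -- the sojourn time follows the arcsine law
    HasLaw (FrictionMotion.sojournTime B t) (FrictionMotion.arcsineLaw t) P ∧
    -- density of `X_m(Γ(t))` given `n` switches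
    FrictionMotion.lawAtClock P (FrictionMotion.eventCount E) (FrictionMotion.position c E θ)
        (FrictionMotion.sojournTime B t) n =
      volume.withDensity (fun x : ℝ =>
        ENNReal.ofReal (1 / (beta 1 (FrictionMotion.shape m n) * Real.pi)) *
          ∫⁻ s in Set.Ioo 0 t, ENNReal.ofReal (1 / Real.sqrt (s * (t - s))) *
            ∫⁻ w in Set.Ioo (0 : ℝ) 1,
              Set.indicator {w : ℝ | |x| < c * s * Real.sqrt w}
                (fun w => ENNReal.ofReal ((1 - w) ^ (FrictionMotion.shape m n - 1) *
                  (1 / Real.pi) * (1 / Real.sqrt (c ^ 2 * s ^ 2 * w - x ^ 2)))) w) ∧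
    -- equality in law with `X_0(Γ(t) √W)` given no switches
    FrictionMotion.lawAtClock P (FrictionMotion.eventCount E) (FrictionMotion.position c E θ)
        (FrictionMotion.sojournTime B t) n =
      FrictionMotion.lawAtClock P' (FrictionMotion.eventCount E')
        (FrictionMotion.position c E' θ')
        (fun ω => FrictionMotion.sojournTime B' t ω * Real.sqrt (W ω)) 0 := by
  have hv := FrictionMotion.shape_pos m hn
  have hWprob := isProbabilityMeasureBeta one_pos hv
  have hTprob := FrictionMotion.isProbabilityMeasure_arcsineLaw ht
  have hΓ := FrictionMotion.hasLaw_sojournTime hBmeas hB ht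
  have hΓ' := FrictionMotion.hasLaw_sojournTime hBmeas' hB' ht
  have hS := FrictionMotion.measurable_sojournFunctional t
  have hpath : Measurable fun ω s => B s ω := measurable_pi_lambda _ hBmeas
  have hpath' : Measurable fun ω s => B' s ω := measurable_pi_lambda _ hBmeas'
  have hae := FrictionMotion.sojournTime_ae_eq hBmeas hB ht
  have hae' := FrictionMotion.sojournTime_ae_eq hBmeas' hB' ht
  have hmap : P.map (fun ω => FrictionMotion.sojournFunctional t fun s => B s ω) =
      FrictionMotion.arcsineLaw t := by rw [← Measure.map_congr hae, hΓ.map_eq]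
  have hmap' : P'.map (fun ω => FrictionMotion.sojournFunctional t fun s => B' s ω) =
      FrictionMotion.arcsineLaw t := by rw [← Measure.map_congr hae', hΓ'.map_eq]
  have hmeas : Measurable fun ω => FrictionMotion.sojournFunctional t fun s => B s ω :=
    hS.comp hpath
  have hmeas' : Measurable fun ω => FrictionMotion.sojournFunctional t fun s => B' s ω :=
    hS.comp hpath'
  have hpos : ∀ᵐ ω ∂P, 0 < FrictionMotion.sojournFunctional t fun s => B s ω := by
    have h := FrictionMotion.ae_mem_Ioo_arcsineLaw t
    rw [← hmap] at h
    exact (ae_of_ae_map hmeas.aemeasurable h).mono fun ω hω => hω.1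
  have hpos' : ∀ᵐ ω ∂P', 0 < (FrictionMotion.sojournFunctional t fun s => B' s ω) * √(W ω) := by
    have h := FrictionMotion.ae_mem_Ioo_arcsineLaw t
    rw [← hmap'] at h
    have hw := FrictionMotion.ae_mem_Ioo_betaMeasure 1 (FrictionMotion.shape m n)
    rw [← hW.map_eq] at hw
    filter_upwards [ae_of_ae_map hmeas'.aemeasurable h, ae_of_ae_map hWmeas.aemeasurable hw]
      with ω h1 h2
    exact mul_pos h1.1 (Real.sqrt_pos.2 h2.1)
  have := FrictionMotion.isProbabilityMeasure_betaCosLaw hv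
  have hlaw := hX.lawAtClock_eq hlam hc hmeas hae hpos (hXB.comp measurable_id hS) n
    (FrictionMotion.ae_abs_le_betaCosLaw hv) (FrictionMotion.integral_pow_betaCosLaw_shape m hn)
  rw [hmap] at hlaw
  refine ⟨hΓ, hlaw.trans (FrictionMotion.bind_arcsineLaw_betaCosLaw hc hv), hlaw.trans ?_⟩
  have : IsProbabilityMeasure ((FrictionMotion.angleLaw 0).map Real.cos) :=
    Measure.isProbabilityMeasure_map (by fun_prop)
  have hclock : P'.map (fun ω => (FrictionMotion.sojournFunctional t fun s => B' s ω) * √(W ω)) =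
      ((FrictionMotion.arcsineLaw t).prod (betaMeasure 1 (FrictionMotion.shape m n))).map
        fun q => q.1 * √q.2 := by
    have hprod := (indepFun_iff_map_prod_eq_prod_map_map hmeas'.aemeasurable
      hWmeas.aemeasurable).1 (hBW'.comp hS measurable_id)
    rw [hmap', hW.map_eq] at hprod
    rw [← hprod, Measure.map_map (by fun_prop) (hmeas'.prodMk hWmeas)]
    rfl
  -- With no change of velocity there is a single leg, so `ρ` is the law of `cos Θ` and the moment
  -- condition holds by the definition of `legMoment`.
  have hlaw' := hX'.lawAtClock_eq hlam hc
    (τ := fun ω => (FrictionMotion.sojournFunctional t fun s => B' s ω) * √(W ω))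
    (hmeas'.mul hWmeas.sqrt)
    (τ' := fun ω => FrictionMotion.sojournTime B' t ω * √(W ω))
    (hae'.mono fun ω hω => by simp [hω]) hpos'
    (hXBW'.comp measurable_id (show Measurable fun q : (ℝ≥0 → ℝ) × ℝ =>
      FrictionMotion.sojournFunctional t q.1 * √q.2 by fun_prop)) 0
    (ρ := (FrictionMotion.angleLaw 0).map Real.cos)
    ((ae_map_iff (by fun_prop) (measurableSet_le measurable_abs measurable_const)).2
      (Filter.Eventually.of_forall Real.abs_cos_le_one))
    fun p => by
      rw [integral_map (by fun_prop) (by fun_prop), FrictionMotion.legMoment, zero_add,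
        Nat.factorial_zero, Nat.cast_one, mul_one, div_self (by positivity), one_mul]
  rw [hlaw', hclock, FrictionMotion.bind_map_mul, FrictionMotion.bind_map_mul,
    FrictionMotion.map_prod_betaCosLaw c hv]
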